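/- **Theorem 5.4.** Let $R$ be the ring of integers of a number field, assume that $R$ is a PID, let $Q(R)$ be its field of fractions, and write $N^\vee=\operatorname{Hom}_R(N,Q(R)/R)$. Let $\mathbb K$ be a field. *Matroids over $R$.* A matroid over $R$ on $[n]=\{1,\dots,n\}$ assigns to every $A\subseteq[n]$ a finitely generated $R$-module $\mathcal M(A)$ such that for all $A\subseteq [n]$ and $b,c\in[n]\setminus A$ there are $x,y\in\mathcal M(A)$ with $\mathcal M(A\cup\{b\})\simeq\mathcal M(A)/(x)$, $\mathcal M(A\cup\{c\})\simeq\mathcal M(A)/(y)$ and $\mathcal M(A\cup\{b,c\})\simeq\mathcal M(A)/(x,y)$. It is realizable if there is a map $\psi:[n]\to\mathcal M(\emptyset)$ (a realization) with $\mathcal M(A)\simeq\mathcal M(\emptyset)/(\psi(i):i\in A)$ for all $A$. Put $\operatorname{rk}(A)=\dim_{Q(R)}(\mathcal M(\emptyset)\otimes_R Q(R))-\dim_{Q(R)}(\mathcal M(A)\otimes_R Q(R))$; the rank of $\mathcal M$ is $r=\operatorname{rk}([n])$, and $A$ is independent if $\operatorname{rk}(A)=|A|$. Let $\operatorname{tor}(A)$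 be the torsion submodule of $\mathcal M(A)$. *Tutte polynomial.* Let $L_0(R\text{-mod})$ be the free abelian group on the isomorphism classes $[N]$ of finitely generated $R$-modules, with product $[N][N']=[N\oplus N']$. The Grothendieck–Tutte polynomial of $\mathcal M$ is $$T_{\mathcal M}(x,y)=\sum_{A\subseteq[n]}[\operatorname{tor}(A)^\vee]\,(x-1)^{r-\operatorname{rk}(A)}(y-1)^{|A|-\operatorname{rk}(A)}\in L_0(R\text{-mod})[x,y].$$ Let $\varphi:L_0(R\text{-mod})\to\mathbb Z$ be the ring homomorphism sending the class of every free module to $1$ and the class of every torsion module to its cardinality, and let $\tilde T_{\mathcal M}(x,y)\in\mathbb Z[x,y]$ be the image of $T_{\mathcal M}$ under the map induced by $\varphi$ on coefficients. *Face module.* Let $\mathcal M$ be realizable, with a realization $\psi$, and identify $\mathcal M(A)$ with $\mathcal M(\emptyset)/(\psi(i):i\in A)$. The poset of torsions is $\operatorname{Gr}\mathcal M=\{(A,l): A\text{ independent},\ l\in\operatorname{tor}(A)^\vee\}$, with the partial order generated by the relations $(A,l)\lhd(A\cup\{b\},h)$, for $b\notin A$, whenever $h$ is sent to $l$ by the dual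 $\operatorname{tor}(A\cup\{b\})^\vee\to\operatorname{tor}(A)^\vee$ of the restriction to torsion parts of the quotient map $\mathcal M(A)\to\mathcal M(A\cup\{b\})$. Let $L=\{p\in\operatorname{Gr}\mathcal M: p\ge(\emptyset,e)\}$, where $e$ is the identity of the group $\operatorname{tor}(\emptyset)^\vee$. The face ring of $L$ is $$A_L=\mathbb K[x_a:a\in L]\Big/\Big(x_{(\emptyset,e)}-1,\ \ x_ax_b-x_{a\wedge b}\sum_{c\in M(a,b)}x_c\ :\ a,b\in L\Big),$$ where $M(a,b)$ is the set of minimal upper bounds of $a,b$ in $L$ and $x_{a\wedge b}=0$ if the meet of $a$ and $b$ in $L$ does not exist; it is graded by letting $\deg x_a$ be the rank of $a$ in $L$, i.e. the maximal length of a chain in $[(\emptyset,e),a]$. The face module of $\mathcal M$ is the $A_L$-module $N_{\mathcal M}=A_L^{|\operatorname{tor}(\emptyset)|}$. *Claim.* If $\mathcal M$ is a realizable matroid over $R$ of rank $r$, then for every realization of $\mathcal M$ the poset $\operatorname{Gr}\mathcal M$ is finite, $N_{\mathcal M}$ is a graded $\mathbb K$-vector space with finite-dimensional homogeneous parts $(N_{\mathcal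 M})_i$, and its Hilbert series $N_{\mathcal M}(t)=\sum_{i\ge0}\dim_{\mathbb K}\big((N_{\mathcal M})_i\big)\,t^i$ is $$N_{\mathcal M}(t)=\frac{t^r}{(1-t)^r}\,\tilde T_{\mathcal M}\!\left(\frac1t,1\right).$$ -/

import Mathlib

open scoped TensorProduct

universe u v

noncomputable section

namespace RMat

/-! ### The ring `L₀(R-mod)` -/

/-- Two finitely generated modules are identified when they are linearly isomorphic. -/
def isoSetoid (R : Type u) [CommRing R] : Setoid (FGModuleCat.{u} R) where
  r M N := Nonempty (M ≃ₗ[R] N)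
  iseqv :=
    ⟨fun _ => ⟨LinearEquiv.refl R _⟩, fun ⟨e⟩ => ⟨e.symm⟩, fun ⟨e⟩ ⟨f⟩ => ⟨e.trans f⟩⟩

/-- Isomorphism classes of finitely generated `R`-modules. -/
def IsoClass (R : Type u) [CommRing R] : Type (u + 1) := Quotient (isoSetoid R)

/-- The isomorphism class of `N`. -/
def isoClass (R : Type u) [CommRing R] (N : Type u) [AddCommGroup N] [Module R N]
    [Module.Finite R N] : IsoClass R :=
  Quotient.mk (isoSetoid R) (FGModuleCat.of R N)

/-- Isomorphism classes multiply by direct sum; the unit is the class of the zero module. -/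
instance (R : Type u) [CommRing R] : CommMonoid (IsoClass R) where
  mul := Quotient.map₂ (fun M N => FGModuleCat.of R (M × N))
    (fun _ _ ⟨e⟩ _ _ ⟨f⟩ => ⟨LinearEquiv.prodCongr e f⟩)
  one := isoClass R PUnit.{u + 1}
  mul_assoc a b c := by
    induction a using Quotient.inductionOn
    induction b using Quotient.inductionOn
    induction c using Quotient.inductionOn
    exact Quotient.sound ⟨LinearEquiv.prodAssoc R _ _ _⟩
  one_mul a := by
    induction a using Quotient.inductionOn
    exact Quotient.sound ⟨LinearEquiv.uniqueProd⟩
  mul_one a := by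
    induction a using Quotient.inductionOn
    exact Quotient.sound ⟨LinearEquiv.prodUnique⟩
  mul_comm a b := by
    induction a using Quotient.inductionOn
    induction b using Quotient.inductionOn
    exact Quotient.sound ⟨LinearEquiv.prodComm R _ _⟩

/-- `L₀(R-mod)`: the free abelian group on the isomorphism classes `[N]` of finitely generated
`R`-modules, with the product `[N][N'] = [N ⊕ N']`. -/
abbrev L0 (R : Type u) [CommRing R] : Type (u + 1) := MonoidAlgebra ℤ (IsoClass R)

/-- The element `[N]` of `L₀(R-mod)`. -/
def cls (R : Type u) [CommRing R] (N : Type u) [AddCommGroup N] [Module R N]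
    [Module.Finite R N] : L0 R :=
  MonoidAlgebra.of ℤ (IsoClass R) (isoClass R N)

theorem cls_prod (R : Type u) [CommRing R] (N N' : Type u) [AddCommGroup N] [Module R N]
    [Module.Finite R N] [AddCommGroup N'] [Module R N'] [Module.Finite R N'] :
    cls R (N × N') = cls R N * cls R N' :=
  (MonoidAlgebra.of ℤ (IsoClass R)).map_mul (isoClass R N) (isoClass R N')

/-! ### The homomorphism `φ : L₀(R-mod) → ℤ` -/

theorem card_torsion_congr (R : Type u) [CommRing R] {M N : Type u} [AddCommGroup M]
    [Module R M] [AddCommGroup N] [Module R N] (e : M ≃ₗ[R] N) :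
    Nat.card (Submodule.torsion R M) = Nat.card (Submodule.torsion R N) := by
  refine Nat.card_congr (e.toEquiv.subtypeEquiv fun x => ?_)
  simp only [Submodule.mem_torsion_iff]
  refine exists_congr fun a => ?_
  change (a : R) • x = 0 ↔ (a : R) • e x = 0
  rw [← e.map_smul, e.map_eq_zero_iff]

theorem card_torsion_prod (R : Type u) [CommRing R] (M N : Type u) [AddCommGroup M]
    [Module R M] [AddCommGroup N] [Module R N] :
    Nat.card (Submodule.torsion R (M × N)) =
      Nat.card (Submodule.torsion R M) * Nat.card (Submodule.torsion R N) := by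
  have h : Submodule.torsion R (M × N) =
      (Submodule.torsion R M).prod (Submodule.torsion R N) := by
    ext ⟨x, y⟩
    simp only [Submodule.mem_torsion_iff, Submodule.mem_prod]
    constructor
    · rintro ⟨a, ha⟩
      exact ⟨⟨a, congrArg Prod.fst ha⟩, ⟨a, congrArg Prod.snd ha⟩⟩
    · rintro ⟨⟨a, ha⟩, ⟨b, hb⟩⟩
      refine ⟨a * b, Prod.ext ?_ ?_⟩
      · change (a * b) • x = 0
        rw [mul_comm, mul_smul, ha, smul_zero]
      · change (a * b) • y = 0
        rw [mul_smul, hb, smul_zero]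
  rw [h, ← Nat.card_prod]
  exact Nat.card_congr (Equiv.Set.prod _ _)

/-- The multiplicative map `[N] ↦ |tor N|`. -/
def torCardHom (R : Type u) [CommRing R] : IsoClass R →* ℤ where
  toFun := Quotient.lift (fun N : FGModuleCat.{u} R => (Nat.card (Submodule.torsion R N) : ℤ))
    (fun _ _ ⟨e⟩ => congrArg Nat.cast (card_torsion_congr R e))
  map_one' := by
    change (Nat.card (Submodule.torsion R PUnit.{u + 1}) : ℤ) = 1
    simp
  map_mul' a b := by
    induction a using Quotient.inductionOn with | _ M
    induction b using Quotient.inductionOn with | _ N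
    change (Nat.card (Submodule.torsion R (M × N)) : ℤ) =
      (Nat.card (Submodule.torsion R M) : ℤ) * (Nat.card (Submodule.torsion R N) : ℤ)
    rw [card_torsion_prod, Nat.cast_mul]

/-- The ring homomorphism `φ : L₀(R-mod) → ℤ` which sends free modules to `1` and torsion modules
to their cardinality (see `phi_free` and `phi_torsion`); on `[N] = [tor N][N / tor N]` its value
is therefore `|tor N|`. -/
def phi (R : Type u) [CommRing R] : L0 R →+* ℤ :=
  (MonoidAlgebra.lift ℤ ℤ (IsoClass R) (torCardHom R)).toRingHom

theorem phi_cls (R : Type u) [CommRing R] (N : Type u) [AddCommGroup N] [Module R N]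
    [Module.Finite R N] : phi R (cls R N) = Nat.card (Submodule.torsion R N) :=
  MonoidAlgebra.lift_of _ _

theorem phi_free (R : Type u) [CommRing R] [IsDomain R] (N : Type u) [AddCommGroup N]
    [Module R N] [Module.Finite R N] [Module.Free R N] : phi R (cls R N) = 1 := by
  have h : Submodule.torsion R N = ⊥ := by
    refine (Submodule.eq_bot_iff _).mpr fun x ⟨a, ha⟩ => ?_
    exact (smul_eq_zero.mp (show (a : R) • x = 0 from ha)).resolve_left
      (nonZeroDivisors.ne_zero a.2)
  rw [phi_cls, h]
  simp

theorem phi_torsion (R : Type u) [CommRing R] (N : Type u) [AddCommGroup N]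
    [Module R N] [Module.Finite R N] (h : Module.IsTorsion R N) :
    phi R (cls R N) = Nat.card N := by
  have h' : Submodule.torsion R N = ⊤ := eq_top_iff.mpr fun _ _ => @h _
  rw [phi_cls, h']
  exact congrArg Nat.cast (Nat.card_congr (Equiv.Set.univ N))

/-! ### The dual `N^∨ = Hom(N, Q(R)/R)` -/

/-- The `R`-module `Q(R)/R`. -/
abbrev FracQuot (R : Type u) [CommRing R] : Type u :=
  FractionRing R ⧸ LinearMap.range (Algebra.linearMap R (FractionRing R))

/-- `N^∨ = Hom_R(N, Q(R)/R)`. -/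
abbrev Dual (R : Type u) [CommRing R] (N : Type u) [AddCommGroup N] [Module R N] : Type u :=
  N →ₗ[R] FracQuot R

/-- Over a Noetherian domain the dual of a finitely generated torsion module is finitely
generated, so that it has a class in `L₀(R-mod)`. -/
theorem finite_dual (R : Type u) [CommRing R] [IsDomain R] [IsNoetherianRing R] (N : Type u)
    [AddCommGroup N] [Module R N] [Module.Finite R N] (h : Module.IsTorsion R N) :
    Module.Finite R (Dual R N) := by
  obtain ⟨d, hd, hd0⟩ := Submodule.annihilator_top_inter_nonZeroDivisors h
  have hd0' : algebraMap R (FractionRing R) d ≠ 0 := by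
    simpa using nonZeroDivisors.ne_zero hd0
  have hdN : ∀ x : N, d • x = 0 := fun x => Submodule.mem_annihilator.mp hd x trivial
  obtain ⟨s, hs⟩ := Module.Finite.fg_top (R := R) (M := N)
  let g : R →ₗ[R] FracQuot R := (Submodule.mkQ _).comp
    (LinearMap.toSpanSingleton R (FractionRing R) (algebraMap R (FractionRing R) d)⁻¹)
  have hg : ∀ y : FracQuot R, d • y = 0 → y ∈ LinearMap.range g := by
    intro y hy
    obtain ⟨q, rfl⟩ := Submodule.mkQ_surjective _ y
    rw [← map_smul, Submodule.mkQ_apply, Submodule.Quotient.mk_eq_zero] at hy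
    obtain ⟨r, hr⟩ := hy
    refine ⟨r, ?_⟩
    change Submodule.mkQ _ (r • (algebraMap R (FractionRing R) d)⁻¹) = _
    congr 1
    rw [Algebra.linearMap_apply, Algebra.smul_def] at hr
    rw [Algebra.smul_def, hr]
    field_simp
  let ev : Dual R N →ₗ[R] (s → LinearMap.range g) :=
    LinearMap.pi fun x =>
      { toFun := fun f => ⟨f x, hg _ (by rw [← map_smul, hdN, map_zero])⟩
        map_add' := fun _ _ => rfl
        map_smul' := fun _ _ => rfl }
  have hev : Function.Injective ev := by
    intro f f' hff
    refine LinearMap.ext_on_range (v := fun x : s => (x : N)) (by simpa using hs) fun x => ?_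
    exact congrArg Subtype.val (congrFun hff x)
  exact Module.Finite.of_injective ev hev

/-! ### Matroids over a ring -/

/-- A matroid of modules over `R` on the ground set `[n]`. -/
structure RMatroid (R : Type u) [CommRing R] (n : ℕ) where
  /-- the finitely generated module `M(A)` -/
  obj : Finset (Fin n) → FGModuleCat.{u} R
  exists_quotients : ∀ (A : Finset (Fin n)) (b c : Fin n), b ∉ A → c ∉ A →
    ∃ x y : obj A,
      Nonempty (obj (insert b A) ≃ₗ[R] (obj A ⧸ Submodule.span R {x})) ∧
      Nonempty (obj (insert c A) ≃ₗ[R] (obj A ⧸ Submodule.span R {y})) ∧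
      Nonempty (obj (insert b (insert c A)) ≃ₗ[R] (obj A ⧸ Submodule.span R {x, y}))

namespace RMatroid

variable {R : Type u} [CommRing R] {n : ℕ}

/-- `tor(A)`, the torsion part of `M(A)`. -/
abbrev tor (M : RMatroid R n) (A : Finset (Fin n)) : Submodule R (M.obj A) :=
  Submodule.torsion R (M.obj A)

/-- The dimension of `M(A) ⊗ Q(R)` over `Q(R)`. -/
def genericDim (M : RMatroid R n) (A : Finset (Fin n)) : ℕ :=
  Module.finrank (FractionRing R) (FractionRing R ⊗[R] M.obj A)

/-- The rank of `A` in the generic matroid. The generic matroid is the classical matroid with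
corank function `A ↦ dim (M_E(A) ⊗ Q(R))`, where `M(A) = M_E(A) ⊕ P` with `P` projective and
independent of `A`, and `M_E` essential; `P` cancels in the difference of two coranks. -/
def rk (M : RMatroid R n) (A : Finset (Fin n)) : ℕ := M.genericDim ∅ - M.genericDim A

/-- The rank of `M`, i.e. of its generic matroid. -/
def rank (M : RMatroid R n) : ℕ := M.rk Finset.univ

/-- `A ∈ ΔM`: the set `A` is independent in the generic matroid. -/
def Indep (M : RMatroid R n) (A : Finset (Fin n)) : Prop := M.rk A = A.card

theorem indep_empty (M : RMatroid R n) : M.Indep ∅ := by simp [Indep, rk]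

/-! ### The Grothendieck-Tutte polynomial -/

/-- `[tor(A)^∨] ∈ L₀(R-mod)`. -/
def torDualClass [IsDomain R] [IsNoetherianRing R] (M : RMatroid R n) (A : Finset (Fin n)) :
    L0 R :=
  haveI : Module.Finite R (Dual R (M.tor A)) :=
    finite_dual R (M.tor A) (Submodule.torsion_isTorsion)
  cls R (Dual R (M.tor A))

/-- The Grothendieck-Tutte polynomial, in the variables `x = X 0` and `y = X 1`:
`T_M(x, y) = ∑_A [tor(A)^∨] (x - 1)^(r - rk A) (y - 1)^(|A| - rk A)`. -/
def tutte [IsDomain R] [IsNoetherianRing R] (M : RMatroid R n) : MvPolynomial (Fin 2) (L0 R) :=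
  ∑ A : Finset (Fin n), MvPolynomial.C (M.torDualClass A) *
    (MvPolynomial.X 0 - 1) ^ (M.rank - M.rk A) * (MvPolynomial.X 1 - 1) ^ (A.card - M.rk A)

/-- `T̃_M ∈ ℤ[x, y]`, the image of `T_M` under the map induced by `φ`. -/
def tutteTilde [IsDomain R] [IsNoetherianRing R] (M : RMatroid R n) : MvPolynomial (Fin 2) ℤ :=
  MvPolynomial.map (phi R) M.tutte

/-! ### Realizations and the poset of torsions -/

/-- The quotient `M(∅) / (ψ(i) : i ∈ A)`. -/
abbrev Quot (M : RMatroid R n) (ψ : Fin n → M.obj ∅) (A : Finset (Fin n)) : Type u :=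
  M.obj ∅ ⧸ Submodule.span R (ψ '' (A : Set (Fin n)))

/-- `ψ` is a realization of `M`: `M(A) ≃ M(∅) / (ψ(i) : i ∈ A)` for all `A`. -/
def IsRealization (M : RMatroid R n) (ψ : Fin n → M.obj ∅) : Prop :=
  ∀ A : Finset (Fin n), Nonempty (M.obj A ≃ₗ[R] M.Quot ψ A)

/-- The torsion part of `M(A)`, where `M(A)` is identified with `M(∅) / (ψ(i) : i ∈ A)`. -/
abbrev rtor (M : RMatroid R n) (ψ : Fin n → M.obj ∅) (A : Finset (Fin n)) :
    Submodule R (M.Quot ψ A) :=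
  Submodule.torsion R (M.Quot ψ A)

/-- The quotient map `M(A) → M(B)` for `A ⊆ B`. -/
def proj (M : RMatroid R n) (ψ : Fin n → M.obj ∅) {A B : Finset (Fin n)} (h : A ⊆ B) :
    M.Quot ψ A →ₗ[R] M.Quot ψ B :=
  Submodule.factor (Submodule.span_mono (Set.image_mono (Finset.coe_subset.mpr h)))

/-- The restriction `tor(A) → tor(B)` of the quotient map, for `A ⊆ B`. -/
def torProj (M : RMatroid R n) (ψ : Fin n → M.obj ∅) {A B : Finset (Fin n)} (h : A ⊆ B) :
    M.rtor ψ A →ₗ[R] M.rtor ψ B :=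
  (M.proj ψ h).restrict fun x ⟨a, ha⟩ => ⟨a, by
    change (a : R) • M.proj ψ h x = 0
    rw [← map_smul, show (a : R) • x = 0 from ha, map_zero]⟩

/-- The dual map `tor(B)^∨ → tor(A)^∨`, for `A ⊆ B`. -/
def dualProj (M : RMatroid R n) (ψ : Fin n → M.obj ∅) {A B : Finset (Fin n)} (h : A ⊆ B) :
    Dual R (M.rtor ψ B) →ₗ[R] Dual R (M.rtor ψ A) :=
  LinearMap.lcomp R (FracQuot R) (M.torProj ψ h)

/-- The set of torsions `Gr M = {(A, l) : A ∈ ΔM, l ∈ tor(A)^∨}`. -/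
@[ext]
structure Gr (M : RMatroid R n) (ψ : Fin n → M.obj ∅) where
  set : Finset (Fin n)
  indep : M.Indep set
  char : Dual R (M.rtor ψ set)

namespace Gr

variable {M : RMatroid R n} {ψ : Fin n → M.obj ∅}

/-- The covering relation: `(A, l) ◁ (A ∪ {b}, h)`, for `b ∉ A`, iff `π_{A,b}^∨(h) = l`. -/
def Cover (p q : Gr M ψ) : Prop :=
  ∃ b ∉ p.set, insert b p.set = q.set ∧ ∃ h : p.set ⊆ q.set, M.dualProj ψ h q.char = p.char

/-- The order on `Gr M` generated by the covering relations. -/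
instance : LE (Gr M ψ) := ⟨Relation.ReflTransGen Cover⟩

theorem eq_or_ssubset_of_le {p q : Gr M ψ} (h : p ≤ q) : p = q ∨ p.set ⊂ q.set := by
  change Relation.ReflTransGen Cover p q at h
  induction h with
  | refl => exact Or.inl rfl
  | @tail q' q'' _ h ih =>
    obtain ⟨b, hb, hbq, -⟩ := h
    have hs : q'.set ⊂ q''.set := hbq ▸ Finset.ssubset_insert hb
    rcases ih with rfl | ih
    · exact Or.inr hs
    · exact Or.inr (ih.trans hs)

instance : PartialOrder (Gr M ψ) where
  le_refl _ := Relation.ReflTransGen.refl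
  le_trans _ _ _ := Relation.ReflTransGen.trans
  le_antisymm p q hpq hqp := by
    rcases eq_or_ssubset_of_le hpq with h | h
    · exact h
    rcases eq_or_ssubset_of_le hqp with h' | h'
    · exact h'.symm
    · exact absurd (h.trans h') (ssubset_irrefl _)

/-- The element `(∅, e)`, with `e` the identity element of `tor(∅)^∨`. -/
def base (M : RMatroid R n) (ψ : Fin n → M.obj ∅) : Gr M ψ := ⟨∅, M.indep_empty, 0⟩

end Gr

/-- The link of `(∅, e)` in `Gr M`: all elements above `(∅, e)`, with the induced order. -/
abbrev Link (M : RMatroid R n) (ψ : Fin n → M.obj ∅) : Type u := Set.Ici (Gr.base M ψ)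

end RMatroid

/-! ### The face ring of a poset -/

section FaceRing

variable (K : Type v) [Field K] (P : Type u) [PartialOrder P] [OrderBot P]

open Classical in
/-- `x_{a ∧ b}`, which is `0` if the meet of `a` and `b` does not exist. -/
def meetVar (a b : P) : MvPolynomial P K :=
  if h : ∃ m, IsGLB {a, b} m then MvPolynomial.X h.choose else 0

/-- `M(a, b)`, the set of minimal upper bounds of `a` and `b`. -/
def minUpperBounds (a b : P) : Set P := {c | Minimal (fun x => a ≤ x ∧ b ≤ x) c}

/-- The face ideal of `P`, for `P` such that all the sets `M(a, b)` are finite; it is generated by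
`x_⊥ - 1` and the `x_a x_b - x_{a ∧ b} ∑_{c ∈ M(a, b)} x_c`. -/
def faceIdeal : Ideal (MvPolynomial P K) :=
  Ideal.span ({MvPolynomial.X ⊥ - 1} ∪ Set.range fun ab : P × P =>
    MvPolynomial.X ab.1 * MvPolynomial.X ab.2 -
      meetVar K P ab.1 ab.2 * ∑ᶠ c ∈ minUpperBounds P ab.1 ab.2, MvPolynomial.X c)

/-- The face ring `A_P`. -/
abbrev FaceRing : Type (max u v) := MvPolynomial P K ⧸ faceIdeal K P

/-- The rank of `a` in `P`: the maximal length of a chain in the segment `[⊥, a]`. -/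
def posetRank (a : P) : ℕ := (Order.height a).toNat

/-- The part of degree `i` of the face ring, for `deg x_a = rk a`. -/
def faceRingDeg (i : ℕ) : Submodule K (FaceRing K P) :=
  (MvPolynomial.weightedHomogeneousSubmodule K (posetRank P) i).map
    (Ideal.Quotient.mkₐ K (faceIdeal K P)).toLinearMap

end FaceRing

namespace RMatroid

variable {R : Type u} [CommRing R] {n : ℕ}

/-- The face module `N_M = A_L^{|tor(∅)|}`, a module over the face ring `A_L` of the link `L` of
`(∅, e)`; it is the direct sum of copies of `A_L` indexed by the elements of `tor(∅)`. -/
abbrev FaceModule (K : Type v) [Field K] (M : RMatroid R n) (ψ : Fin n → M.obj ∅) :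
    Type (max u v) :=
  M.tor ∅ →₀ FaceRing K (M.Link ψ)

/-- The part of degree `i` of the face module: all coordinates are of degree `i` in `A_L`. -/
def faceModuleDeg (K : Type v) [Field K] (M : RMatroid R n) (ψ : Fin n → M.obj ∅) (i : ℕ) :
    Submodule K (FaceModule K M ψ) :=
  Finsupp.submodule fun _ => faceRingDeg K (M.Link ψ) i

end RMatroid

/-- The Hilbert series `∑ dim_K(N_i) t^i` of a graded `K`-vector space. -/
def hilbertSeries (K : Type v) [Field K] {N : Type*} [AddCommGroup N] [Module K N]
    (𝒩 : ℕ → Submodule K N) : PowerSeries ℚ :=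
  PowerSeries.mk fun i => (Module.finrank K (𝒩 i) : ℚ)

/-- The specialization `T(1/t, 1)` of `T ∈ ℤ[x, y]`, in the field of Laurent series in `t`. -/
def specialize (T : MvPolynomial (Fin 2) ℤ) : LaurentSeries ℚ :=
  MvPolynomial.eval₂ (Int.castRingHom (LaurentSeries ℚ))
    ![((PowerSeries.X : PowerSeries ℚ) : LaurentSeries ℚ)⁻¹, 1] T

end RMat

end

/-! The link L of (∅, e) is a finite simplicial poset: the elements below (A, l) correspond to the
subsets of A, each carrying the character obtained by pulling l back.

The face ring of such a poset has a basis of standard monomials, one for each element p and each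
exponent vector m whose support is exactly the set of vertices of p. The monomial is the product of
the variables at the elements below p whose label sets are the layers {v : k < m v}, a descending
chain that starts at p. These products span because the defining relations rewrite a variable times
a standard monomial as a sum of standard monomials (`faceVar_mul_stdFamily_mem`). They are
independent because restriction to a segment [⊥, c] maps the face ring to a polynomial ring, where
the standard monomials below c become distinct monomials and all others vanish
(`stdCoeff_stdFamily`). Hence the Hilbert series of A_L is the sum of (t/(1-t))^|p| over p in L,
with |p| the number of vertices of p.

It remains to count the elements of L over an independent set A. They form the kernel of tor(A)^∨ →
tor(∅)^∨. The vectors ψ(i), i ∈ A, span a free module, so tor(∅) embeds into tor(A). As Q(R)/R is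
injective, the dual map is onto, and the kernel has |tor(A)|/|tor(∅)| elements
(`card_link_fiber_mul`). The |tor(∅)| copies of A_L clear the denominator, and the series becomes
the sum of |tor(A)| (t/(1-t))^|A| over independent A. On the Tutte side, y = 1 kills the dependent
sets, duality preserves the cardinality of torsion modules, and t^r/(1-t)^r times (1/t - 1)^(r-|A|)
is (t/(1-t))^|A|. -/

noncomputable section

namespace RMat

open MvPolynomial

/-! ### Simplicial posets -/

/-- Data which exhibit `P` as a simplicial poset with vertices labelled by `V`, such that the
vertices below any given element have distinct labels: `sp p` is the set of labels of the
vertices below `p`, and `res p A` is the element below `p` with set of labels `sp p ∩ A`. -/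
structure IsSimplicial {P : Type u} [PartialOrder P] {V : Type*} [DecidableEq V]
    (sp : P → Finset V) (res : P → Finset V → P) : Prop where
  mono : ∀ {p q}, p ≤ q → sp p ⊆ sp q
  res_le : ∀ p A, res p A ≤ p
  sp_res : ∀ p A, sp (res p A) = sp p ∩ A
  eq_res : ∀ {a p}, a ≤ p → a = res p (sp a)

namespace IsSimplicial

variable {P : Type u} [PartialOrder P] {V : Type*} [DecidableEq V]
  {sp : P → Finset V} {res : P → Finset V → P}

/-- Below a common upper bound `q` an element is determined by its label set, so `a` must be the
restriction of `b` to `sp a`. -/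
theorem le_of_subset (h : IsSimplicial sp res) {a b q : P} (ha : a ≤ q) (hb : b ≤ q)
    (hab : sp a ⊆ sp b) : a ≤ b := by
  have h1 : sp (res b (sp a)) = sp a := by rw [h.sp_res, Finset.inter_eq_right.mpr hab]
  have h2 : res b (sp a) = res q (sp (res b (sp a))) := h.eq_res ((h.res_le _ _).trans hb)
  rw [h1, ← h.eq_res ha] at h2
  exact h2 ▸ h.res_le _ _

theorem eq_of_sp_eq (h : IsSimplicial sp res) {a b q : P} (ha : a ≤ q) (hb : b ≤ q)
    (hab : sp a = sp b) : a = b := by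
  rw [h.eq_res ha, h.eq_res hb, hab]

theorem res_self (h : IsSimplicial sp res) (p : P) : res p (sp p) = p := (h.eq_res le_rfl).symm

theorem strictMono (h : IsSimplicial sp res) : StrictMono sp := fun _ _ hab =>
  (h.mono hab.le).lt_of_ne fun he => hab.ne (h.eq_of_sp_eq hab.le le_rfl he)

theorem sp_bot [OrderBot P] (h : IsSimplicial sp res) : sp ⊥ = ∅ := by
  have := h.mono (bot_le (a := res ⊥ ∅))
  rwa [h.sp_res, Finset.inter_empty, Finset.subset_empty] at this

theorem eq_bot [OrderBot P] (h : IsSimplicial sp res) {p : P} (hp : sp p = ∅) : p = ⊥ :=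
  h.eq_of_sp_eq le_rfl bot_le (hp.trans h.sp_bot.symm)

/-- The number of vertices is strictly monotone, and restriction realizes every smaller value below
`p`, so it equals the height. -/
theorem posetRank_eq (h : IsSimplicial sp res) (p : P) : posetRank P p = (sp p).card := by
  have hm : StrictMono fun q => (sp q).card := fun _ _ hab => Finset.card_lt_card (h.strictMono hab)
  rw [posetRank, Order.height_eq_of_strictMono _ hm, Order.height_nat, ENat.toNat_natCast]
  intro a b hb
  obtain ⟨A, hA, rfl⟩ := Finset.exists_subset_card_eq hb.le
  have hs : sp (res a A) = A := by rw [h.sp_res, Finset.inter_eq_right.mpr hA]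
  refine ⟨res a A, (h.res_le _ _).lt_of_ne fun he => ?_, congrArg _ hs⟩
  rw [← hs, he] at hb
  exact hb.false

theorem isGLB (h : IsSimplicial sp res) {a b q : P} (ha : a ≤ q) (hb : b ≤ q) :
    IsGLB {a, b} (res q (sp a ∩ sp b)) := by
  have hs : sp (res q (sp a ∩ sp b)) ⊆ sp a ∩ sp b := by
    rw [h.sp_res]; exact Finset.inter_subset_right
  refine ⟨?_, fun d hd => ?_⟩
  · rintro x (rfl | rfl)
    · exact h.le_of_subset (h.res_le _ _) ha (hs.trans Finset.inter_subset_left)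
    · exact h.le_of_subset (h.res_le _ _) hb (hs.trans Finset.inter_subset_right)
  · have hda : d ≤ a := hd (by simp)
    have hdb : d ≤ b := hd (by simp)
    refine h.le_of_subset (hda.trans ha) (h.res_le _ _) ?_
    rw [h.sp_res]
    exact Finset.subset_inter (h.mono (hda.trans ha))
      (Finset.subset_inter (h.mono hda) (h.mono hdb))

theorem sp_res_union (h : IsSimplicial sp res) {a b q : P} (ha : a ≤ q) (hb : b ≤ q) :
    sp (res q (sp a ∪ sp b)) = sp a ∪ sp b := by
  rw [h.sp_res, Finset.inter_eq_right.mpr (Finset.union_subset (h.mono ha) (h.mono hb))]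

theorem le_res_union_left (h : IsSimplicial sp res) {a b q : P} (ha : a ≤ q) (hb : b ≤ q) :
    a ≤ res q (sp a ∪ sp b) :=
  h.le_of_subset ha (h.res_le _ _) (by rw [h.sp_res_union ha hb]; exact Finset.subset_union_left)

theorem le_res_union_right (h : IsSimplicial sp res) {a b q : P} (ha : a ≤ q) (hb : b ≤ q) :
    b ≤ res q (sp a ∪ sp b) :=
  h.le_of_subset hb (h.res_le _ _) (by rw [h.sp_res_union ha hb]; exact Finset.subset_union_right)

/-- Restricting an upper bound `c` to `sp a ∪ sp b` gives an upper bound below `c`, so a minimal one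
has no further vertices. -/
theorem mem_minUpperBounds (h : IsSimplicial sp res) {a b c : P} :
    c ∈ minUpperBounds P a b ↔ a ≤ c ∧ b ≤ c ∧ sp c = sp a ∪ sp b := by
  constructor
  · rintro ⟨⟨ha, hb⟩, hmin⟩
    refine ⟨ha, hb, ?_⟩
    have hle : res c (sp a ∪ sp b) ≤ c := h.res_le _ _
    have := hmin ⟨h.le_res_union_left ha hb, h.le_res_union_right ha hb⟩ hle
    rw [← h.sp_res_union ha hb, le_antisymm hle this]
  · rintro ⟨ha, hb, hc⟩
    refine ⟨⟨ha, hb⟩, fun d ⟨had, hbd⟩ hdc => ?_⟩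
    refine h.le_of_subset le_rfl hdc ?_
    rw [hc]
    exact Finset.union_subset (h.mono had) (h.mono hbd)

theorem meetVar_eq (h : IsSimplicial sp res) (K : Type v) [Field K] {a b q : P} (ha : a ≤ q)
    (hb : b ≤ q) : meetVar K P a b = X (res q (sp a ∩ sp b)) := by
  have hg : ∃ m, IsGLB {a, b} m := ⟨_, h.isGLB ha hb⟩
  rw [meetVar, dif_pos hg, hg.choose_spec.unique (h.isGLB ha hb)]

end IsSimplicial

/-! ### Level sets of exponent vectors -/

section Levels

variable {V : Type*}

/-- The set of all `v` with `k < m v`. -/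
def level (m : V →₀ ℕ) (k : ℕ) : Finset V := m.support.filter fun v => k < m v

theorem mem_level {m : V →₀ ℕ} {k : ℕ} {v : V} : v ∈ level m k ↔ k < m v := by
  simp only [level, Finset.mem_filter, Finsupp.mem_support_iff, and_iff_right_iff_imp]
  lia

theorem level_zero (m : V →₀ ℕ) : level m 0 = m.support := by
  ext v; simp [mem_level, Nat.pos_iff_ne_zero]

theorem apply_le_degree (m : V →₀ ℕ) (v : V) : m v ≤ m.degree := by
  by_cases hv : v ∈ m.support
  · exact Finset.single_le_sum (f := fun v => m v) (fun _ _ => Nat.zero_le _) hv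
  · simp [Finsupp.notMem_support_iff.mp hv]

theorem level_eq_empty {m : V →₀ ℕ} {k : ℕ} (hk : m.degree ≤ k) : level m k = ∅ :=
  Finset.eq_empty_of_forall_notMem fun v hv =>
    absurd (mem_level.mp hv) (not_lt.mpr ((apply_le_degree m v).trans hk))

variable [DecidableEq V]

/-- The exponent vector of a squarefree monomial. -/
def sqfree (A : Finset V) : V →₀ ℕ := Finsupp.indicator A fun _ _ => 1

theorem sqfree_apply (A : Finset V) (v : V) : sqfree A v = if v ∈ A then 1 else 0 := by
  simp [sqfree, Finsupp.indicator_apply]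

theorem sqfree_empty : sqfree (∅ : Finset V) = 0 := by ext; simp [sqfree_apply]

theorem support_sqfree (A : Finset V) : (sqfree A).support = A := by
  ext; simp [sqfree_apply]

theorem degree_sqfree (A : Finset V) : (sqfree A).degree = A.card := by
  rw [Finsupp.degree_apply, support_sqfree, Finset.card_eq_sum_ones]
  exact Finset.sum_congr rfl fun v hv => by simp [sqfree_apply, hv]

theorem sqfree_inter_add_union (A B : Finset V) :
    sqfree (A ∩ B) + sqfree (A ∪ B) = sqfree A + sqfree B := by
  ext v
  simp only [Finsupp.add_apply, sqfree_apply, Finset.mem_inter, Finset.mem_union]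
  by_cases hA : v ∈ A <;> by_cases hB : v ∈ B <;> simp [hA, hB]

/-- Layer-cake decomposition: `v` lies in exactly the layers `k < m v`. -/
theorem sum_sqfree_level (m : V →₀ ℕ) : ∑ k ∈ Finset.range m.degree, sqfree (level m k) = m := by
  ext v
  simp only [Finsupp.finsetSum_apply, sqfree_apply, mem_level, Finset.sum_boole, Nat.cast_id]
  have : (Finset.range m.degree).filter (· < m v) = Finset.range (m v) := by
    ext k
    simp only [Finset.mem_filter, Finset.mem_range, and_iff_right_iff_imp]
    exact fun hk => hk.trans_le (apply_le_degree m v)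
  rw [this, Finset.card_range]

theorem level_add_sqfree_zero (m : V →₀ ℕ) (A : Finset V) (hm : m.support ⊆ A) :
    level (m + sqfree A) 0 = A := by
  ext v
  simp only [mem_level, Finsupp.add_apply, sqfree_apply]
  by_cases hv : v ∈ A
  · simp [hv]
  · simp [hv, Finsupp.notMem_support_iff.mp (fun h => hv (hm h))]

theorem level_add_sqfree_succ (m : V →₀ ℕ) (A : Finset V) (hm : m.support ⊆ A) (k : ℕ) :
    level (m + sqfree A) (k + 1) = level m k := by
  ext v
  simp only [mem_level, Finsupp.add_apply, sqfree_apply]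
  by_cases hv : v ∈ A
  · simp [hv]
  · simp [hv, Finsupp.notMem_support_iff.mp (fun h => hv (hm h))]

end Levels

/-! ### The face ring of a simplicial poset -/

section FaceRing

variable (K : Type v) [Field K] {P : Type u} [PartialOrder P] [OrderBot P]

/-- The class of the variable `x_a` in the face ring. -/
def faceVar (a : P) : FaceRing K P := Ideal.Quotient.mk _ (X a)

theorem faceVar_bot : faceVar K (⊥ : P) = 1 := by
  rw [faceVar, ← map_one (Ideal.Quotient.mk _), Ideal.Quotient.mk_eq_mk_iff_sub_mem]
  exact Ideal.subset_span (Or.inl rfl)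

theorem faceVar_mul [Finite P] (a b : P) : faceVar K a * faceVar K b =
    Ideal.Quotient.mk _ (meetVar K P a b) * ∑ᶠ c ∈ minUpperBounds P a b, faceVar K c := by
  have h : Ideal.Quotient.mk (faceIdeal K P) (∑ᶠ c ∈ minUpperBounds P a b, X c) =
      ∑ᶠ c ∈ minUpperBounds P a b, faceVar K c :=
    (Ideal.Quotient.mk (faceIdeal K P)).toAddMonoidHom.map_finsum_mem _ (Set.toFinite _)
  rw [← h, faceVar, faceVar, ← map_mul, ← map_mul, Ideal.Quotient.mk_eq_mk_iff_sub_mem]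
  exact Ideal.subset_span (Or.inr ⟨(a, b), rfl⟩)

variable {V : Type*} [DecidableEq V]
  {sp : P → Finset V} {res : P → Finset V → P}

theorem faceVar_mul_eq_zero [Finite P] {a b : P} (hab : ∀ q, a ≤ q → ¬ b ≤ q) :
    faceVar K a * faceVar K b = 0 := by
  have h : minUpperBounds P a b = ∅ :=
    Set.eq_empty_of_forall_notMem fun c hc => hab c hc.1.1 hc.1.2
  rw [faceVar_mul, h, finsum_mem_empty, mul_zero]

/-- The factor `x_q` selects one term of the relation: a minimal upper bound of `a` and `b` that has
a common upper bound with `q` has the same labels as the one below `q`, hence equals it. All other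
terms are killed, so in the presence of `x_q` the variables below `q` multiply as in a Boolean
lattice. -/
theorem faceVar_mul_mul [Finite P] (h : IsSimplicial sp res) {a b q : P} (ha : a ≤ q)
    (hb : b ≤ q) : faceVar K q * (faceVar K a * faceVar K b) =
      faceVar K q * (faceVar K (res q (sp a ∩ sp b)) * faceVar K (res q (sp a ∪ sp b))) := by
  have hs : faceVar K q * ∑ᶠ c ∈ minUpperBounds P a b, faceVar K c =
      faceVar K q * faceVar K (res q (sp a ∪ sp b)) := by
    rw [finsum_mem_eq_finite_toFinset_sum _ (Set.toFinite _), Finset.mul_sum]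
    refine Finset.sum_eq_single _ (fun c hc hne => ?_) (fun hn => absurd ?_ hn)
    · rw [Set.Finite.mem_toFinset, h.mem_minUpperBounds] at hc
      refine faceVar_mul_eq_zero K fun d hqd hcd => hne ?_
      exact h.eq_of_sp_eq hcd ((h.res_le _ _).trans hqd) (hc.2.2.trans (h.sp_res_union ha hb).symm)
    · rw [Set.Finite.mem_toFinset, h.mem_minUpperBounds]
      exact ⟨h.le_res_union_left ha hb, h.le_res_union_right ha hb, h.sp_res_union ha hb⟩
  rw [faceVar_mul, h.meetVar_eq K ha hb, mul_left_comm, hs, mul_left_comm]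
  rfl

theorem faceVar_mul_res_mul_res [Finite P] (h : IsSimplicial sp res) (q : P) (A B : Finset V) :
    faceVar K q * (faceVar K (res q A) * faceVar K (res q B)) =
      faceVar K q * (faceVar K (res q (A ∩ B)) * faceVar K (res q (A ∪ B))) := by
  rw [faceVar_mul_mul K h (h.res_le _ _) (h.res_le _ _)]
  congr 3
  · refine h.eq_of_sp_eq (h.res_le _ _) (h.res_le _ _) ?_
    simp only [h.sp_res]
    grind
  · refine h.eq_of_sp_eq (h.res_le _ _) (h.res_le _ _) ?_
    simp only [h.sp_res]
    grind

theorem faceVar_res_empty (h : IsSimplicial sp res) (q : P) : faceVar K (res q ∅) = 1 := by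
  rw [h.eq_bot (p := res q ∅) (by rw [h.sp_res, Finset.inter_empty]), faceVar_bot]

/-- The standard monomial with exponent vector `m` on the vertices below `q`. -/
def stdMonomial (res : P → Finset V → P) (q : P) (m : V →₀ ℕ) : FaceRing K P :=
  ∏ k ∈ Finset.range m.degree, faceVar K (res q (level m k))

/-- Layers beyond the degree are empty and contribute `x_⊥ = 1`, so the product may be padded to a
common length. -/
theorem stdMonomial_eq (h : IsSimplicial sp res) (q : P) (m : V →₀ ℕ) {N : ℕ}
    (hN : m.degree ≤ N) :
    stdMonomial K res q m = ∏ k ∈ Finset.range N, faceVar K (res q (level m k)) := by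
  refine Finset.prod_subset (Finset.range_mono hN) fun k _ hk => ?_
  rw [level_eq_empty (not_lt.mp fun h => hk (Finset.mem_range.mpr h)), faceVar_res_empty K h]

/-- Inserting `B` into the descending chain of layers: at each layer the union stays and the
intersection is carried on. After `N` layers the carry is the part of `B` where `m` is at least `N`.
-/
theorem faceVar_mul_stdMonomial_aux [Finite P] (h : IsSimplicial sp res) (q : P) (B : Finset V)
    (m : V →₀ ℕ) (N : ℕ) :
    faceVar K q * (faceVar K (res q B) * ∏ k ∈ Finset.range N, faceVar K (res q (level m k))) =
      faceVar K q * (faceVar K (res q (B.filter fun v => N ≤ m v)) *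
        ∏ k ∈ Finset.range N, faceVar K (res q (level (m + sqfree B) k))) := by
  induction N with
  | zero => simp
  | succ N ih =>
    rw [Finset.prod_range_succ, ← mul_assoc (faceVar K (res q B)), ← mul_assoc (faceVar K q), ih,
      mul_assoc, mul_right_comm, ← mul_assoc (faceVar K q), faceVar_mul_res_mul_res K h,
      Finset.prod_range_succ, mul_assoc, mul_assoc, mul_comm (∏ _ ∈ _, _)]
    congr 5
    · ext v
      simp only [Finset.mem_inter, Finset.mem_filter, mem_level]
      grind
    · ext v
      simp only [Finset.mem_union, Finset.mem_filter, mem_level, Finsupp.add_apply, sqfree_apply]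
      grind

theorem faceVar_mul_stdMonomial_of_le [Finite P] (h : IsSimplicial sp res) {b q : P} (hb : b ≤ q)
    (m : V →₀ ℕ) : faceVar K q * (faceVar K b * stdMonomial K res q m) =
      faceVar K q * stdMonomial K res q (m + sqfree (sp b)) := by
  -- `N` exceeds every exponent of `m`, so the final carry is empty.
  set N := (m + sqfree (sp b)).degree + 1
  have hd : (m + sqfree (sp b)).degree = m.degree + (sqfree (sp b)).degree := map_add _ _ _
  rw [stdMonomial_eq K h q m (N := N) (by lia), stdMonomial_eq K h q _ (N := N) (by lia)]
  have he : ((sp b).filter fun v => N ≤ m v) = ∅ := by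
    refine Finset.eq_empty_of_forall_notMem fun v hv => ?_
    have := apply_le_degree m v
    have := (Finset.mem_filter.mp hv).2
    lia
  have := faceVar_mul_stdMonomial_aux K h q (sp b) m N
  rwa [← h.eq_res hb, he, faceVar_res_empty K h, one_mul] at this

/-- Here `x_q` becomes a new top layer, and the old layers move down by one. -/
theorem faceVar_mul_stdMonomial_self (h : IsSimplicial sp res) {q : P} {m : V →₀ ℕ}
    (hm : m.support ⊆ sp q) : faceVar K q * stdMonomial K res q m =
      stdMonomial K res q (m + sqfree (sp q)) := by
  have hd : (m + sqfree (sp q)).degree = m.degree + (sqfree (sp q)).degree := map_add _ _ _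
  set N := (m + sqfree (sp q)).degree
  rw [stdMonomial_eq K h q m (N := N) (by lia), stdMonomial_eq K h q _ (N := N + 1) (by lia),
    Finset.prod_range_succ', level_add_sqfree_zero _ _ hm, h.res_self, mul_comm]
  simp only [level_add_sqfree_succ _ _ hm]

theorem stdMonomial_res_eq (h : IsSimplicial sp res) {p q : P} (hpq : p ≤ q) {m : V →₀ ℕ}
    (hm : m.support ⊆ sp p) : stdMonomial K res p m = stdMonomial K res q m := by
  refine Finset.prod_congr rfl fun k _ => congrArg _ ?_
  refine h.eq_of_sp_eq ((h.res_le _ _).trans hpq) (h.res_le _ _) ?_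
  have : level m k ⊆ sp p := (Finset.filter_subset _ _).trans hm
  rw [h.sp_res, h.sp_res, Finset.inter_eq_right.mpr this,
    Finset.inter_eq_right.mpr (this.trans (h.mono hpq))]

/-- The index set of the standard monomials: pairs of an element `p` and an exponent vector whose
support is the set of all vertices below `p`. -/
abbrev StdIndex (sp : P → Finset V) : Type _ := {s : P × (V →₀ ℕ) // s.2.support = sp s.1}

/-- The family of all standard monomials. -/
def stdFamily (res : P → Finset V → P) (s : StdIndex sp) : FaceRing K P :=
  stdMonomial K res s.1.1 s.1.2

/-- Split the top layer `x_p` off the monomial and expand `x_b x_p` by the defining relation. Each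
upper bound `q` leaves `x_q` times `x_{b ∧ p}` times a monomial supported below `q`. The meet is
absorbed in the presence of `x_q`, and then `x_q` becomes the new top layer, which makes the support
exactly `sp q`. -/
theorem faceVar_mul_stdFamily_mem [Finite P] (h : IsSimplicial sp res) (b : P) (s : StdIndex sp) :
    faceVar K b * stdFamily K res s ∈ Submodule.span K (Set.range (stdFamily K (sp := sp) res)) := by
  obtain ⟨⟨p, m⟩, hm : m.support = sp p⟩ := s
  change faceVar K b * stdMonomial K res p m ∈ _
  have hle : sqfree (sp p) ≤ m := by
    intro v
    rw [sqfree_apply]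
    split_ifs with hv
    · rw [← hm, Finsupp.mem_support_iff] at hv
      lia
    · exact Nat.zero_le _
  obtain ⟨m', rfl⟩ := exists_add_of_le hle
  have hm' : m'.support ⊆ sp p := by
    rw [← hm, add_comm]
    intro v hv
    rw [Finsupp.mem_support_iff] at hv ⊢
    simp only [Finsupp.add_apply]
    lia
  rw [add_comm, ← faceVar_mul_stdMonomial_self K h hm', ← mul_assoc, faceVar_mul,
    finsum_mem_eq_finite_toFinset_sum _ (Set.toFinite _), mul_assoc, Finset.sum_mul,
    Finset.mul_sum]
  refine Submodule.sum_mem _ fun q hq => ?_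
  rw [Set.Finite.mem_toFinset, h.mem_minUpperBounds] at hq
  obtain ⟨hbq, hpq, hq⟩ := hq
  have hsub : (m' + sqfree (sp (res q (sp b ∩ sp p)))).support ⊆ sp q := by
    refine Finsupp.support_add.trans (Finset.union_subset (hm'.trans (h.mono hpq)) ?_)
    rw [support_sqfree]
    exact h.mono (h.res_le _ _)
  rw [h.meetVar_eq K hbq hpq, stdMonomial_res_eq K h hpq hm', mul_left_comm]
  change faceVar K q * (faceVar K _ * _) ∈ _
  rw [faceVar_mul_stdMonomial_of_le K h (h.res_le _ _), faceVar_mul_stdMonomial_self K h hsub]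
  refine Submodule.subset_span ⟨⟨(q, _), ?_⟩, rfl⟩
  rw [← level_zero, level_add_sqfree_zero _ _ hsub]

/-- The span contains 1 and is stable under multiplication by every variable. -/
theorem span_stdFamily [Finite P] (h : IsSimplicial sp res) :
    ⊤ ≤ Submodule.span K (Set.range (stdFamily K (sp := sp) res)) := by
  set W := Submodule.span K (Set.range (stdFamily K (sp := sp) res))
  have h1 : (1 : FaceRing K P) ∈ W :=
    Submodule.subset_span ⟨⟨(⊥, 0), by simp [h.sp_bot]⟩, by simp [stdFamily, stdMonomial]⟩
  have hmul (b : P) : ∀ f ∈ W, faceVar K b * f ∈ W := by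
    intro f hf
    induction hf using Submodule.span_induction with
    | mem x hx =>
      obtain ⟨s, rfl⟩ := hx
      exact faceVar_mul_stdFamily_mem K h b s
    | zero => rw [mul_zero]; exact W.zero_mem
    | add x y _ _ hx hy => rw [mul_add]; exact W.add_mem hx hy
    | smul a x _ hx => rw [mul_smul_comm]; exact W.smul_mem _ hx
  rintro f -
  obtain ⟨p, rfl⟩ := Ideal.Quotient.mk_surjective f
  induction p using MvPolynomial.induction_on with
  | C a =>
    have : Ideal.Quotient.mk (faceIdeal K P) (C a) = a • (1 : FaceRing K P) := by
      rw [← map_one (Ideal.Quotient.mk (faceIdeal K P)), ← Ideal.Quotient.mkₐ_eq_mk K,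
        ← map_smul, MvPolynomial.smul_eq_C_mul, mul_one]
    rw [this]
    exact W.smul_mem _ h1
  | add p q hp hq => rw [map_add]; exact W.add_mem hp hq
  | mul_X p b hp => rw [map_mul, mul_comm]; exact hmul b _ hp

end FaceRing

/-! ### Independence of the standard monomials, and the grading -/

section FaceRingBasis

variable (K : Type v) [Field K] {P : Type u} [PartialOrder P] [OrderBot P]
  {V : Type*} [DecidableEq V] {sp : P → Finset V} {res : P → Finset V → P}

open Classical in
/-- The image of `x_a` under the restriction of the face ring to the segment `[⊥, c]`. -/
def restrictVar (sp : P → Finset V) (c a : P) : MvPolynomial V K :=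
  if a ≤ c then monomial (sqfree (sp a)) 1 else 0

omit [OrderBot P] [DecidableEq V] in
theorem restrictVar_of_le {a c : P} (hac : a ≤ c) :
    restrictVar K sp c a = monomial (sqfree (sp a)) 1 := if_pos hac

omit [OrderBot P] [DecidableEq V] in
theorem restrictVar_of_not_le {a c : P} (hac : ¬ a ≤ c) : restrictVar K sp c a = 0 := if_neg hac

/-- If `a` and `b` lie below `c`, exactly one minimal upper bound does too, and the relation reduces
to `sqfree_inter_add_union`. Otherwise no upper bound lies below `c`, and both sides vanish. -/
theorem faceIdeal_le_ker [Finite P] (h : IsSimplicial sp res) (c : P) :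
    faceIdeal K P ≤ RingHom.ker (aeval (restrictVar K sp c)) := by
  rw [faceIdeal, Ideal.span_le, Set.union_subset_iff, Set.singleton_subset_iff]
  constructor
  · rw [SetLike.mem_coe, RingHom.mem_ker, map_sub, aeval_X, map_one, restrictVar_of_le K bot_le,
      h.sp_bot, sqfree_empty]
    exact sub_self _
  rintro _ ⟨⟨a, b⟩, rfl⟩
  rw [SetLike.mem_coe, RingHom.mem_ker, map_sub, map_mul, map_mul, aeval_X, aeval_X,
    finsum_mem_eq_finite_toFinset_sum _ (Set.toFinite _), map_sum, sub_eq_zero]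
  simp only [aeval_X]
  by_cases hab : a ≤ c ∧ b ≤ c
  · obtain ⟨ha, hb⟩ := hab
    rw [h.meetVar_eq K ha hb, aeval_X, Finset.sum_eq_single (res c (sp a ∪ sp b)),
      restrictVar_of_le K ha, restrictVar_of_le K hb, restrictVar_of_le K (h.res_le _ _),
      restrictVar_of_le K (h.res_le _ _), monomial_mul, monomial_mul, h.sp_res_union ha hb,
      h.sp_res, Finset.inter_eq_right.mpr (Finset.inter_subset_left.trans (h.mono ha)),
      sqfree_inter_add_union]
    · intro d hd hne
      rw [Set.Finite.mem_toFinset, h.mem_minUpperBounds] at hd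
      refine restrictVar_of_not_le K fun hdc => hne ?_
      exact h.eq_of_sp_eq hdc (h.res_le _ _) (hd.2.2.trans (h.sp_res_union ha hb).symm)
    · intro hn
      refine absurd ?_ hn
      rw [Set.Finite.mem_toFinset, h.mem_minUpperBounds]
      exact ⟨h.le_res_union_left ha hb, h.le_res_union_right ha hb, h.sp_res_union ha hb⟩
  · have h0 : restrictVar K sp c a * restrictVar K sp c b = 0 := by
      by_cases ha : a ≤ c
      · rw [restrictVar_of_not_le K fun hb => hab ⟨ha, hb⟩, mul_zero]
      · rw [restrictVar_of_not_le K ha, zero_mul]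
    rw [h0, Finset.sum_eq_zero, mul_zero]
    intro d hd
    rw [Set.Finite.mem_toFinset, h.mem_minUpperBounds] at hd
    exact restrictVar_of_not_le K fun hdc => hab ⟨hd.1.trans hdc, hd.2.1.trans hdc⟩

/-- The restriction of the face ring to the face ring of the segment `[⊥, c]`. -/
def restrictHom [Finite P] (h : IsSimplicial sp res) (c : P) :
    FaceRing K P →ₐ[K] MvPolynomial V K :=
  Ideal.Quotient.liftₐ _ (aeval (restrictVar K sp c)) fun _ ha => faceIdeal_le_ker K h c ha

theorem restrictHom_mk [Finite P] (h : IsSimplicial sp res) (c : P) (p : MvPolynomial P K) :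
    restrictHom K h c (Ideal.Quotient.mk _ p) = aeval (restrictVar K sp c) p :=
  Ideal.Quotient.lift_mk _ _ _

theorem restrictHom_faceVar [Finite P] (h : IsSimplicial sp res) (c a : P) :
    restrictHom K h c (faceVar K a) = restrictVar K sp c a := by
  rw [faceVar, restrictHom_mk, aeval_X]

theorem restrictHom_stdFamily_of_le [Finite P] (h : IsSimplicial sp res) {c : P}
    (s : StdIndex sp) (hs : s.1.1 ≤ c) :
    restrictHom K h c (stdFamily K res s) = monomial s.1.2 1 := by
  rw [stdFamily, stdMonomial, map_prod]
  conv_rhs => rw [← sum_sqfree_level s.1.2, monomial_sum_one]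
  refine Finset.prod_congr rfl fun k _ => ?_
  have hk : level s.1.2 k ⊆ sp s.1.1 := s.2 ▸ Finset.filter_subset _ _
  rw [restrictHom_faceVar, restrictVar_of_le K ((h.res_le _ _).trans hs), h.sp_res,
    Finset.inter_eq_right.mpr hk]

theorem restrictHom_stdFamily_of_not_le [Finite P] (h : IsSimplicial sp res) {c : P}
    (s : StdIndex sp) (hs : ¬ s.1.1 ≤ c) : restrictHom K h c (stdFamily K res s) = 0 := by
  have hm : s.1.2.degree ≠ 0 := by
    intro h0
    rw [Finsupp.degree_eq_zero_iff] at h0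
    have := s.2
    rw [h0, Finsupp.support_zero] at this
    exact hs (h.eq_bot this.symm ▸ bot_le)
  rw [stdFamily, stdMonomial, map_prod]
  -- The layer 0 is the whole support, so this factor is the variable of the top element, which does
  -- not lie below `c`.
  refine Finset.prod_eq_zero (i := 0) (Finset.mem_range.mpr (Nat.pos_of_ne_zero hm)) ?_
  rw [restrictHom_faceVar, level_zero, s.2, h.res_self, restrictVar_of_not_le K hs]

/-- The functional dual to a standard monomial. -/
def stdCoeff [Finite P] (h : IsSimplicial sp res) (s : StdIndex sp) : FaceRing K P →ₗ[K] K :=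
  (lcoeff K s.1.2).comp (restrictHom K h s.1.1).toLinearMap

theorem stdCoeff_apply [Finite P] (h : IsSimplicial sp res) (s : StdIndex sp)
    (f : FaceRing K P) : stdCoeff K h s f = coeff s.1.2 (restrictHom K h s.1.1 f) := rfl

/-- The exponent vector determines the label set, and only one element below `s.1.1` has the labels
of `s.1.1`. -/
theorem stdCoeff_stdFamily [Finite P] (h : IsSimplicial sp res) (s t : StdIndex sp) :
    stdCoeff K h s (stdFamily K res t) = Finsupp.single t (1 : K) s := by
  classical
  rw [stdCoeff_apply]
  by_cases hle : t.1.1 ≤ s.1.1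
  · rw [restrictHom_stdFamily_of_le K h t hle, coeff_monomial, Finsupp.single_apply]
    congr 1
    refine propext ⟨fun hts => ?_, fun hts => hts ▸ rfl⟩
    refine Subtype.ext (Prod.ext ?_ hts)
    exact h.eq_of_sp_eq hle le_rfl (by rw [← t.2, ← s.2, hts])
  · rw [restrictHom_stdFamily_of_not_le K h t hle, coeff_zero, Finsupp.single_eq_of_ne]
    rintro rfl
    exact hle le_rfl

theorem linearIndependent_stdFamily [Finite P] (h : IsSimplicial sp res) :
    LinearIndependent K (stdFamily K (sp := sp) res) := by
  rw [linearIndependent_iff]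
  intro l hl
  ext s
  have := congrArg (stdCoeff K h s) hl
  rw [Finsupp.linearCombination_apply, Finsupp.sum, map_sum, map_zero] at this
  simp only [map_smul, stdCoeff_stdFamily, smul_eq_mul] at this
  rw [Finsupp.coe_zero, Pi.zero_apply, ← this]
  conv_lhs => rw [← Finsupp.sum_single l, Finsupp.sum, Finsupp.finsetSum_apply]
  refine Finset.sum_congr rfl fun t _ => ?_
  rw [← smul_eq_mul, ← Finsupp.smul_apply, Finsupp.smul_single_one]

/-- The basis of the face ring which consists of the standard monomials. -/
def stdBasis [Finite P] (h : IsSimplicial sp res) :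
    Module.Basis (StdIndex sp) K (FaceRing K P) :=
  Module.Basis.mk (linearIndependent_stdFamily K h) (span_stdFamily K h)

theorem stdBasis_apply [Finite P] (h : IsSimplicial sp res) (s : StdIndex sp) :
    stdBasis K h s = stdFamily K res s := Module.Basis.mk_apply _ _ _

theorem stdBasis_repr [Finite P] (h : IsSimplicial sp res) (f : FaceRing K P)
    (s : StdIndex sp) : (stdBasis K h).repr f s = stdCoeff K h s f := by
  have : (Finsupp.lapply s).comp (stdBasis K h).repr.toLinearMap = stdCoeff K h s := by
    refine (stdBasis K h).ext fun t => ?_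
    rw [stdBasis_apply, stdCoeff_stdFamily, ← stdBasis_apply K h]
    simp
  exact LinearMap.congr_fun this f

omit [OrderBot P] in
theorem isHomogeneous_restrictVar (h : IsSimplicial sp res) (c a : P) :
    (restrictVar K sp c a).IsHomogeneous (posetRank P a) := by
  by_cases hac : a ≤ c
  · rw [restrictVar_of_le K hac, h.posetRank_eq, ← degree_sqfree]
    exact isHomogeneous_monomial _ rfl
  · rw [restrictVar_of_not_le K hac]
    exact isHomogeneous_zero _ _ _

theorem isHomogeneous_aeval {σ τ : Type*} {w : σ → ℕ} {g : σ → MvPolynomial τ K}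
    (hg : ∀ a, (g a).IsHomogeneous (w a)) {p : MvPolynomial σ K} {i : ℕ}
    (hp : p.IsWeightedHomogeneous w i) : (aeval g p).IsHomogeneous i := by
  rw [aeval_def, eval₂_eq]
  refine IsHomogeneous.sum _ _ _ fun d hd => ?_
  have hd' := hp (mem_support_iff.mp hd)
  rw [← zero_add i, ← hd', Finsupp.weight_apply, Finsupp.sum]
  refine (isHomogeneous_C _ _).mul (IsHomogeneous.prod _ _ _ fun a _ => ?_)
  rw [smul_eq_mul, mul_comm]
  exact (hg a).pow _

theorem stdFamily_mem_faceRingDeg (h : IsSimplicial sp res) (s : StdIndex sp) :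
    stdFamily K res s ∈ faceRingDeg K P s.1.2.degree := by
  refine ⟨∏ k ∈ Finset.range s.1.2.degree, X (res s.1.1 (level s.1.2 k)), ?_, ?_⟩
  · have hd : s.1.2.degree =
        ∑ k ∈ Finset.range s.1.2.degree, posetRank P (res s.1.1 (level s.1.2 k)) := by
      conv_lhs => rw [← sum_sqfree_level s.1.2, map_sum]
      refine Finset.sum_congr rfl fun k _ => ?_
      have hk : level s.1.2 k ⊆ sp s.1.1 := s.2 ▸ Finset.filter_subset _ _
      rw [degree_sqfree, h.posetRank_eq, h.sp_res, Finset.inter_eq_right.mpr hk]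
    rw [SetLike.mem_coe, mem_weightedHomogeneousSubmodule]
    nth_rw 2 [hd]
    exact IsWeightedHomogeneous.prod _ _ _ fun k _ => isWeightedHomogeneous_X _ _ _
  · rw [AlgHom.toLinearMap_apply, map_prod]
    rfl

/-- The homogeneous elements of the face ring are those whose coordinates in the basis of standard
monomials are concentrated in one degree. -/
theorem mem_faceRingDeg_iff [Finite P] (h : IsSimplicial sp res) {i : ℕ} {f : FaceRing K P} :
    f ∈ faceRingDeg K P i ↔ ∀ s, (stdBasis K h).repr f s ≠ 0 → s.1.2.degree = i := by
  constructor
  · rintro ⟨p, hp, rfl⟩ s hs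
    rw [stdBasis_repr, stdCoeff_apply, AlgHom.toLinearMap_apply, Ideal.Quotient.mkₐ_eq_mk,
      restrictHom_mk] at hs
    -- Restriction to a segment preserves degrees, so a coordinate of any other degree is a
    -- vanishing coefficient of a homogeneous polynomial.
    by_contra hne
    exact hs ((isHomogeneous_aeval K (isHomogeneous_restrictVar K h s.1.1) hp).coeff_eq_zero hne)
  · intro hf
    rw [← (stdBasis K h).linearCombination_repr f, Finsupp.linearCombination_apply]
    refine Submodule.sum_mem _ fun s hs => Submodule.smul_mem _ _ ?_
    rw [stdBasis_apply, ← hf s (Finsupp.mem_support_iff.mp hs)]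
    exact stdFamily_mem_faceRingDeg K h s

end FaceRingBasis

/-! ### Gradings which come from a basis -/

section BasisGrading

variable {K : Type*} [Field K] {N : Type*} [AddCommGroup N] [Module K N] {ι : Type*}
  (b : Module.Basis ι K N) (d : ι → ℕ) (𝒩 : ℕ → Submodule K N)

theorem isInternal_of_basis (h𝒩 : ∀ i x, x ∈ 𝒩 i ↔ ∀ j, b.repr x j ≠ 0 → d j = i) :
    DirectSum.IsInternal 𝒩 := by
  -- Applied below with `S` the complement of one degree, which gives the independence of the parts.
  have hsup (S : Set ℕ) : ⨆ i ∈ S, 𝒩 i ≤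
      (Finsupp.supported K K (d ⁻¹' S)).comap b.repr.toLinearMap := by
    refine iSup₂_le fun i hi x hx => ?_
    rw [Submodule.mem_comap, Finsupp.mem_supported]
    intro j hj
    rw [Set.mem_preimage, (h𝒩 i x).mp hx j (Finsupp.mem_support_iff.mp hj)]
    exact hi
  refine DirectSum.isInternal_submodule_of_iSupIndep_of_iSup_eq_top ?_ ?_
  · intro i
    rw [Submodule.disjoint_def]
    intro x hx hx'
    have h2 := hsup {j | j ≠ i} hx'
    rw [Submodule.mem_comap, Finsupp.mem_supported] at h2
    refine b.ext_elem fun j => ?_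
    rw [map_zero, Finsupp.coe_zero, Pi.zero_apply]
    by_contra hj
    exact h2 (Finsupp.mem_support_iff.mpr hj) ((h𝒩 i x).mp hx j hj)
  · rw [eq_top_iff, ← b.span_eq, Submodule.span_le]
    rintro _ ⟨j, rfl⟩
    refine Submodule.mem_iSup_of_mem (d j) ((h𝒩 _ _).mpr fun k hk => ?_)
    rw [b.repr_self] at hk
    by_contra hne
    exact hk (Finsupp.single_eq_of_ne fun hjk => hne (hjk ▸ rfl))

/-- A homogeneous part has as many dimensions as there are basis elements of its degree. -/
theorem nonempty_linearEquiv_of_basis (h𝒩 : ∀ i x, x ∈ 𝒩 i ↔ ∀ j, b.repr x j ≠ 0 → d j = i)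
    (i : ℕ) : Nonempty (𝒩 i ≃ₗ[K] ({j // d j = i} →₀ K)) := by
  have : 𝒩 i = (Finsupp.supported K K {j | d j = i}).comap b.repr.toLinearMap := by
    ext x
    rw [h𝒩, Submodule.mem_comap, Finsupp.mem_supported]
    simp [Set.subset_def]
  exact ⟨(LinearEquiv.ofEq _ _ this).trans
    ((b.repr.ofSubmodule' (Finsupp.supported K K {j | d j = i})).trans
      (Finsupp.supportedEquivFinsupp _))⟩

theorem finrank_of_basis (h𝒩 : ∀ i x, x ∈ 𝒩 i ↔ ∀ j, b.repr x j ≠ 0 → d j = i)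
    (i : ℕ) : Module.finrank K (𝒩 i) = Nat.card {j // d j = i} := by
  obtain ⟨e⟩ := nonempty_linearEquiv_of_basis b d 𝒩 h𝒩 i
  rw [e.finrank_eq, Module.finrank_eq_nat_card_basis Finsupp.basisSingleOne]

theorem finite_of_basis (h𝒩 : ∀ i x, x ∈ 𝒩 i ↔ ∀ j, b.repr x j ≠ 0 → d j = i)
    (i : ℕ) [Finite {j // d j = i}] : Module.Finite K (𝒩 i) := by
  obtain ⟨e⟩ := nonempty_linearEquiv_of_basis b d 𝒩 h𝒩 i
  exact Module.Finite.equiv e.symm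

end BasisGrading

/-! ### Counting standard monomials -/

section Counting

variable {V : Type*} [DecidableEq V]

/-- The exponent vectors with given support and given degree. -/
def exponents (A : Finset V) (i : ℕ) : Finset (V →₀ ℕ) :=
  (A.finsuppAntidiag i).filter fun m => m.support = A

theorem mem_exponents {A : Finset V} {i : ℕ} {m : V →₀ ℕ} :
    m ∈ exponents A i ↔ m.degree = i ∧ m.support = A := by
  rw [exponents, Finset.mem_filter, Finset.mem_finsuppAntidiag]
  constructor
  · rintro ⟨⟨h1, -⟩, h2⟩
    exact ⟨by rw [← h1, Finsupp.degree_apply, h2], h2⟩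
  · rintro ⟨h1, h2⟩
    exact ⟨⟨by rw [← h1, Finsupp.degree_apply, h2], h2.le⟩, h2⟩

/-- Each element of `A` contributes a factor t + t² + ⋯; the missing constant term forces full
support. -/
theorem mk_card_exponents (A : Finset V) :
    PowerSeries.mk (fun i => ((exponents A i).card : ℚ)) =
      (PowerSeries.X * (1 - PowerSeries.X)⁻¹) ^ A.card := by
  have hgeom : (PowerSeries.X * (1 - PowerSeries.X)⁻¹ : PowerSeries ℚ) =
      PowerSeries.mk fun k => if k = 0 then 0 else 1 := by
    rw [eq_comm, PowerSeries.eq_mul_inv_iff_mul_eq (by simp)]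
    ext k
    rw [mul_sub, mul_one, map_sub]
    rcases k with _ | _ | k <;> simp [PowerSeries.coeff_succ_mul_X, PowerSeries.coeff_X]
  rw [hgeom, ← Finset.prod_const]
  ext i
  rw [PowerSeries.coeff_prod, PowerSeries.coeff_mk, exponents, Finset.card_filter, Nat.cast_sum]
  refine Finset.sum_congr rfl fun m hm => ?_
  rw [Finset.mem_finsuppAntidiag] at hm
  simp only [PowerSeries.coeff_mk]
  split_ifs with h
  · rw [Nat.cast_one, Finset.prod_eq_one]
    intro j hj
    rw [← h, Finsupp.mem_support_iff] at hj
    rw [if_neg hj]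
  · rw [Nat.cast_zero, eq_comm, Finset.prod_eq_zero_iff]
    obtain ⟨j, hj, hjm⟩ := Finset.not_subset.mp fun hA => h (hm.2.antisymm hA)
    exact ⟨j, hj, if_pos (Finsupp.notMem_support_iff.mp hjm)⟩

variable {P : Type u} [PartialOrder P] [OrderBot P] (sp : P → Finset V)

/-- Standard monomials of given degree, sorted by the top element. -/
def stdIndexDegEquiv (i : ℕ) :
    {s : StdIndex sp // s.1.2.degree = i} ≃
      (p : P) × exponents (sp p) i where
  toFun s := ⟨s.1.1.1, s.1.1.2, mem_exponents.mpr ⟨s.2, s.1.2⟩⟩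
  invFun s := ⟨⟨(s.1, s.2.1), (mem_exponents.mp s.2.2).2⟩, (mem_exponents.mp s.2.2).1⟩
  left_inv := fun ⟨⟨⟨_, _⟩, _⟩, _⟩ => rfl
  right_inv := fun ⟨_, _, _⟩ => rfl

end Counting

/-! ### Duality of finitely generated torsion modules -/

section Duality

variable (R : Type u) [CommRing R] [IsDomain R]

/-- A map on a principal ideal (d) extends by dividing its value at d by d in Q(R). -/
theorem baer_fracQuot [IsPrincipalIdealRing R] : Module.Baer R (FracQuot R) := by
  intro I g
  obtain ⟨d, rfl⟩ := IsPrincipalIdealRing.principal I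
  obtain ⟨q, hq⟩ := Submodule.mkQ_surjective _ (g ⟨d, Submodule.mem_span_singleton_self d⟩)
  by_cases hd : d = 0
  · refine ⟨0, fun x hx => ?_⟩
    have hx0 : (⟨x, hx⟩ : Submodule.span R {d}) = 0 := by
      subst hd
      simpa using hx
    rw [hx0, map_zero, LinearMap.zero_apply]
  · have hd' : algebraMap R (FractionRing R) d ≠ 0 := by simpa using hd
    refine ⟨LinearMap.toSpanSingleton R _
      (Submodule.mkQ _ ((algebraMap R (FractionRing R) d)⁻¹ * q)), fun x hx => ?_⟩
    obtain ⟨r, rfl⟩ := Submodule.mem_span_singleton.mp hx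
    have hr : (⟨r • d, hx⟩ : Submodule.span R {d}) =
        r • ⟨d, Submodule.mem_span_singleton_self d⟩ := rfl
    rw [hr, map_smul g, ← hq, LinearMap.toSpanSingleton_apply, smul_assoc, ← map_smul,
      Algebra.smul_def d, mul_inv_cancel_left₀ hd']

/-- A homomorphism out of R/(d) is a d-torsion element of Q(R)/R, and these form the cyclic module
generated by 1/d, whose annihilator is (d). -/
theorem card_dual_quotient {d : R} (hd : d ≠ 0) :
    Nat.card (Dual R (R ⧸ Submodule.span R {d})) = Nat.card (R ⧸ Submodule.span R {d}) := by
  have hd' : algebraMap R (FractionRing R) d ≠ 0 := by simpa using hd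
  let g : R →ₗ[R] FracQuot R := LinearMap.toSpanSingleton R _
    (Submodule.mkQ _ (algebraMap R (FractionRing R) d)⁻¹)
  have hg (r : R) : g r = Submodule.mkQ _ (r • (algebraMap R (FractionRing R) d)⁻¹) := rfl
  have hker : LinearMap.ker g = Submodule.span R {d} := by
    ext r
    rw [LinearMap.mem_ker, hg, Submodule.mkQ_apply, Submodule.Quotient.mk_eq_zero,
      Submodule.mem_span_singleton, LinearMap.mem_range]
    refine exists_congr fun a => ?_
    rw [Algebra.linearMap_apply, Algebra.smul_def, eq_mul_inv_iff_mul_eq₀ hd', ← map_mul,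
      smul_eq_mul]
    exact (FaithfulSMul.algebraMap_injective R (FractionRing R)).eq_iff
  have hrange : LinearMap.range g = Submodule.torsionBy R (FracQuot R) d := by
    ext y
    obtain ⟨q, rfl⟩ := Submodule.mkQ_surjective _ y
    rw [Submodule.mem_torsionBy_iff, ← map_smul, Submodule.mkQ_apply _ (d • q),
      Submodule.Quotient.mk_eq_zero]
    constructor
    · rintro ⟨r, hr⟩
      rw [hg, ← sub_eq_zero, ← map_sub, Submodule.mkQ_apply, Submodule.Quotient.mk_eq_zero] at hr
      obtain ⟨a, ha⟩ := hr
      refine ⟨r - d * a, ?_⟩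
      rw [Algebra.linearMap_apply] at ha ⊢
      rw [map_sub, map_mul, ha, Algebra.smul_def, Algebra.smul_def]
      field_simp
      ring
    · rintro ⟨r, hr⟩
      refine ⟨r, ?_⟩
      rw [Algebra.linearMap_apply, Algebra.smul_def] at hr
      rw [hg, Algebra.smul_def, hr]
      congr 1
      field_simp
  let ev : Dual R (R ⧸ Submodule.span R {d}) → Submodule.torsionBy R (FracQuot R) d := fun f =>
    ⟨f (Submodule.mkQ _ 1), by
      rw [Submodule.mem_torsionBy_iff, ← map_smul, ← map_smul, smul_eq_mul, mul_one,
        Submodule.mkQ_apply,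
        (Submodule.Quotient.mk_eq_zero _).mpr (Submodule.mem_span_singleton_self d), map_zero]⟩
  have hev : Function.Bijective ev := by
    constructor
    · intro f f' hff
      refine Submodule.linearMap_qext _ (LinearMap.ext_ring ?_)
      exact congrArg Subtype.val hff
    · intro y
      refine ⟨Submodule.liftQSpanSingleton d (LinearMap.toSpanSingleton R _ y.1) y.2, ?_⟩
      exact Subtype.ext (one_smul R y.1)
  rw [Nat.card_eq_of_bijective ev hev, ← hrange, ← hker]
  exact (Nat.card_congr g.quotKerEquivRange.toEquiv).symm

variable [IsPrincipalIdealRing R] {N : Type u} [AddCommGroup N] [Module R N] [Module.Finite R N]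

/-- The structure theorem reduces this to cyclic modules, since the dual of a finite sum is the
product of the duals. -/
theorem card_dual (h : Module.IsTorsion R N) : Nat.card (Dual R N) = Nat.card N := by
  classical
  obtain ⟨ι, _, p, hp, e, ⟨E⟩⟩ := Module.equiv_directSum_of_isTorsion h
  let E' := E.trans (DirectSum.linearEquivFunOnFintype R ι fun i => R ⧸ Submodule.span R {p i ^ e i})
  rw [Nat.card_congr (E'.congrLeft (FracQuot R) R).toEquiv, Nat.card_congr E'.toEquiv,
    ← Nat.card_congr (LinearMap.lsum R (fun i => R ⧸ Submodule.span R {p i ^ e i}) R).toEquiv,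
    Nat.card_pi, Nat.card_pi]
  exact Finset.prod_congr rfl fun i _ => card_dual_quotient R (pow_ne_zero _ (hp i).ne_zero)

theorem finite_of_isTorsion [Ring.HasFiniteQuotients R] (h : Module.IsTorsion R N) : Finite N := by
  classical
  obtain ⟨ι, _, p, hp, e, ⟨E⟩⟩ := Module.equiv_directSum_of_isTorsion h
  let E' := E.trans (DirectSum.linearEquivFunOnFintype R ι fun i => R ⧸ Submodule.span R {p i ^ e i})
  have (i : ι) : Finite (R ⧸ Submodule.span R {p i ^ e i}) :=
    Ring.HasFiniteQuotients.finiteQuotient (I := Ideal.span {p i ^ e i}) (by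
      rw [Ne, Ideal.span_singleton_eq_bot]
      exact pow_ne_zero _ (hp i).ne_zero)
  exact Finite.of_equiv _ E'.toEquiv.symm

omit [IsDomain R] [IsPrincipalIdealRing R] in
theorem isTorsion_dual (h : Module.IsTorsion R N) : Module.IsTorsion R (Dual R N) := by
  obtain ⟨d, hd, hd0⟩ := Submodule.annihilator_top_inter_nonZeroDivisors h
  refine fun f => ⟨⟨d, hd0⟩, LinearMap.ext fun x => ?_⟩
  change d • f x = 0
  rw [← map_smul, Submodule.mem_annihilator.mp hd x trivial, map_zero]

theorem finite_dual_of_isTorsion [Ring.HasFiniteQuotients R] (h : Module.IsTorsion R N) :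
    Finite (Dual R N) :=
  haveI := finite_dual R N h
  finite_of_isTorsion R (isTorsion_dual R h)

/-- The kernel of the dual of an embedding of torsion modules. -/
theorem card_ker_lcomp_mul {N' : Type u} [AddCommGroup N'] [Module R N'] [Module.Finite R N']
    (h : Module.IsTorsion R N) (h' : Module.IsTorsion R N') (f : N →ₗ[R] N')
    (hf : Function.Injective f) :
    Nat.card (LinearMap.ker (LinearMap.lcomp R (FracQuot R) f)) * Nat.card N = Nat.card N' := by
  -- Injectivity of Q(R)/R: characters of `N` extend along the embedding.
  have hs : Function.Surjective (LinearMap.lcomp R (FracQuot R) f) :=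
    (baer_fracQuot R).extension_property f hf
  rw [← card_dual R h', ← card_dual R h,
    ← Nat.card_congr ((LinearMap.lcomp R (FracQuot R) f).quotKerEquivOfSurjective hs).toEquiv]
  exact (Submodule.card_eq_card_quotient_mul_card _).symm

end Duality

/-! ### The generic matroid of a realizable matroid -/

namespace RMatroid

variable {R : Type u} [CommRing R] [IsDomain R] {n : ℕ} {M : RMatroid R n} {ψ : Fin n → M.obj ∅}

theorem genericDim_eq (M : RMatroid R n) (A : Finset (Fin n)) :
    M.genericDim A = Module.finrank R (M.obj A) :=
  (TensorProduct.isBaseChange R (M.obj A) (FractionRing R)).finrank_eq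

/-- Additivity of the rank in M(∅) → M(A); it also shows that the truncated subtraction in `rk`
loses nothing. -/
theorem rk_eq_finrank_span (hψ : M.IsRealization ψ) (A : Finset (Fin n)) :
    M.rk A = Module.finrank R (Submodule.span R (ψ '' (A : Set (Fin n)))) := by
  obtain ⟨e⟩ := hψ A
  rw [rk, genericDim_eq, genericDim_eq, e.finrank_eq,
    ← Submodule.finrank_quotient_add_finrank (Submodule.span R (ψ '' (A : Set (Fin n)))),
    Nat.add_sub_cancel_left]

theorem indep_iff (hψ : M.IsRealization ψ) (A : Finset (Fin n)) :
    M.Indep A ↔ LinearIndepOn R ψ (A : Set (Fin n)) := by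
  have hr : Set.range (fun x : (A : Set (Fin n)) => ψ x) = ψ '' (A : Set (Fin n)) := by
    ext; simp
  rw [LinearIndepOn, linearIndependent_iff_card_eq_finrank_span, hr, Set.finrank, Indep,
    rk_eq_finrank_span hψ, eq_comm]
  simp

theorem Indep.subset (hψ : M.IsRealization ψ) {A B : Finset (Fin n)} (hB : M.Indep B)
    (hAB : A ⊆ B) : M.Indep A := by
  rw [indep_iff hψ] at hB ⊢
  exact hB.mono (Finset.coe_subset.mpr hAB)

theorem rk_le_card (hψ : M.IsRealization ψ) (A : Finset (Fin n)) : M.rk A ≤ A.card := by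
  classical
  rw [rk_eq_finrank_span hψ, ← Finset.coe_image]
  exact (finrank_span_finset_le_card _).trans Finset.card_image_le

theorem rk_le_rank (hψ : M.IsRealization ψ) (A : Finset (Fin n)) : M.rk A ≤ M.rank := by
  rw [rank, rk_eq_finrank_span hψ, rk_eq_finrank_span hψ]
  have := Module.Finite.span_of_finite R
    (Set.toFinite (ψ '' ((Finset.univ : Finset (Fin n)) : Set (Fin n))))
  exact Submodule.finrank_mono (Submodule.span_mono (Set.image_mono (by simp)))

/-- The kernel is the torsion inside the span of independent vectors, which is free and so
torsion-free. -/
theorem torProj_injective (hψ : M.IsRealization ψ) {A : Finset (Fin n)} (hA : M.Indep A) :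
    Function.Injective (M.torProj ψ (Finset.empty_subset A)) := by
  rw [indep_iff hψ] at hA
  rw [injective_iff_map_eq_zero]
  rintro ⟨x, a, hax⟩ hx
  obtain ⟨y, rfl⟩ := Submodule.mkQ_surjective _ x
  replace hx : M.proj ψ (Finset.empty_subset A) (Submodule.mkQ _ y) = 0 := congrArg Subtype.val hx
  replace hx : y ∈ Submodule.span R (ψ '' (A : Set (Fin n))) :=
    (Submodule.Quotient.mk_eq_zero _).mp hx
  replace hax : (a : R) • y ∈ Submodule.span R (ψ '' ((∅ : Finset (Fin n)) : Set (Fin n))) :=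
    (Submodule.Quotient.mk_eq_zero _).mp hax
  rw [Finset.coe_empty, Set.image_empty, Submodule.span_empty, Submodule.mem_bot] at hax
  rw [Set.image_eq_range] at hx
  have hfree := Module.Free.of_basis (Module.Basis.span hA)
  have hy : (⟨y, hx⟩ : Submodule.span R (Set.range fun x : (A : Set (Fin n)) => ψ x)) = 0 :=
    (smul_eq_zero.mp (Subtype.ext hax)).resolve_left (nonZeroDivisors.ne_zero a.2)
  obtain rfl : y = 0 := congrArg Subtype.val hy
  exact Subtype.ext (map_zero _)

/-! ### The order on the poset of torsions -/

omit [IsDomain R] in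
theorem proj_proj {A B C : Finset (Fin n)} (h : A ⊆ B) (h' : B ⊆ C) (x : M.Quot ψ A) :
    M.proj ψ h' (M.proj ψ h x) = M.proj ψ (h.trans h') x :=
  Submodule.factor_comp_apply (Submodule.span_mono (Set.image_mono (Finset.coe_subset.mpr h)))
    (Submodule.span_mono (Set.image_mono (Finset.coe_subset.mpr h'))) x

omit [IsDomain R] in
theorem torProj_torProj {A B C : Finset (Fin n)} (h : A ⊆ B) (h' : B ⊆ C) (x : M.rtor ψ A) :
    M.torProj ψ h' (M.torProj ψ h x) = M.torProj ψ (h.trans h') x :=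
  Subtype.ext (proj_proj h h' x.1)

omit [IsDomain R] in
theorem dualProj_dualProj {A B C : Finset (Fin n)} (h : A ⊆ B) (h' : B ⊆ C)
    (l : Dual R (M.rtor ψ C)) :
    M.dualProj ψ h (M.dualProj ψ h' l) = M.dualProj ψ (h.trans h') l :=
  LinearMap.ext fun x => congrArg l (torProj_torProj h h' x)

omit [IsDomain R] in
theorem dualProj_refl {A : Finset (Fin n)} (h : A ⊆ A) (l : Dual R (M.rtor ψ A)) :
    M.dualProj ψ h l = l := by
  refine LinearMap.ext fun x => congrArg l ?_
  obtain ⟨x, hx⟩ := x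
  obtain ⟨y, rfl⟩ := Submodule.mkQ_surjective _ x
  rfl

namespace Gr

omit [IsDomain R] in
theorem ext_of_dualProj {p q : Gr M ψ} (hs : p.set = q.set)
    (hc : M.dualProj ψ hs.subset q.char = p.char) : p = q := by
  obtain ⟨A, hA, l⟩ := p
  obtain ⟨B, hB, l'⟩ := q
  obtain rfl : A = B := hs
  rw [dualProj_refl] at hc
  obtain rfl : l' = l := hc
  rfl

/-- The element `(p.set ∩ A, l)` below `p`. -/
def restrict (hψ : M.IsRealization ψ) (p : Gr M ψ) (A : Finset (Fin n)) : Gr M ψ :=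
  ⟨p.set ∩ A, p.indep.subset hψ Finset.inter_subset_left,
    M.dualProj ψ Finset.inter_subset_left p.char⟩

/-- Pullbacks compose, so a chain of covers amounts to one pullback. Conversely, adding the missing
elements one at a time, each with the pullback of the character of `q`, gives such a chain. -/
theorem le_iff (hψ : M.IsRealization ψ) {p q : Gr M ψ} :
    p ≤ q ↔ ∃ h : p.set ⊆ q.set, M.dualProj ψ h q.char = p.char := by
  constructor
  · intro h
    change Relation.ReflTransGen Cover p q at h
    induction h with
    | refl => exact ⟨subset_rfl, dualProj_refl _ _⟩
    | tail _ hc ih =>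
      obtain ⟨-, -, -, h, hc⟩ := hc
      obtain ⟨h', hc'⟩ := ih
      exact ⟨h'.trans h, by rw [← dualProj_dualProj h' h, hc, hc']⟩
  · rintro ⟨h, hc⟩
    change Relation.ReflTransGen Cover p q
    induction hk : (q.set \ p.set).card generalizing p with
    | zero =>
      have hs : p.set = q.set :=
        h.antisymm (Finset.sdiff_eq_empty_iff_subset.mp (Finset.card_eq_zero.mp hk))
      rw [ext_of_dualProj hs hc]
    | succ k ih =>
      obtain ⟨b, hb⟩ := Finset.card_pos.mp (hk.symm ▸ k.succ_pos : 0 < (q.set \ p.set).card)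
      rw [Finset.mem_sdiff] at hb
      have hbq : insert b p.set ⊆ q.set := Finset.insert_subset hb.1 h
      let p' : Gr M ψ := ⟨insert b p.set, q.indep.subset hψ hbq, M.dualProj ψ hbq q.char⟩
      refine Relation.ReflTransGen.head (b := p')
        ⟨b, hb.2, rfl, Finset.subset_insert _ _, ?_⟩ (ih hbq rfl ?_)
      · exact (dualProj_dualProj _ _ _).trans hc
      · change (q.set \ insert b p.set).card = k
        rw [Finset.sdiff_insert, Finset.card_erase_of_mem (Finset.mem_sdiff.mpr hb), hk]
        rfl

theorem restrict_le (hψ : M.IsRealization ψ) (p : Gr M ψ) (A : Finset (Fin n)) :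
    p.restrict hψ A ≤ p := (le_iff hψ).mpr ⟨Finset.inter_subset_left, rfl⟩

theorem eq_restrict (hψ : M.IsRealization ψ) {p q : Gr M ψ} (h : p ≤ q) :
    p = q.restrict hψ p.set := by
  obtain ⟨hs, hc⟩ := (le_iff hψ).mp h
  refine ext_of_dualProj (Finset.inter_eq_right.mpr hs).symm ?_
  rw [← hc]
  exact dualProj_dualProj _ _ _

theorem base_le_iff (hψ : M.IsRealization ψ) {p : Gr M ψ} :
    base M ψ ≤ p ↔ M.dualProj ψ (Finset.empty_subset p.set) p.char = 0 :=
  (le_iff hψ).trans ⟨fun ⟨_, h⟩ => h, fun h => ⟨Finset.empty_subset p.set, h⟩⟩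

theorem base_le_restrict (hψ : M.IsRealization ψ) {p : Gr M ψ} (h : base M ψ ≤ p)
    (A : Finset (Fin n)) : base M ψ ≤ p.restrict hψ A := by
  rw [base_le_iff hψ] at h ⊢
  exact (dualProj_dualProj _ _ _).trans h

end Gr

/-- The link of `(∅, e)` is a simplicial poset. -/
theorem isSimplicial_link (hψ : M.IsRealization ψ) :
    IsSimplicial (fun p : M.Link ψ => p.1.set)
      (fun p A => ⟨p.1.restrict hψ A, Gr.base_le_restrict hψ p.2 A⟩) where
  mono h := ((Gr.le_iff hψ).mp h).1
  res_le p A := Gr.restrict_le hψ p.1 A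
  sp_res _ _ := rfl
  eq_res h := Subtype.ext (Gr.eq_restrict hψ h)

/-! ### The number of elements of the link -/

omit [IsDomain R] in
theorem card_tor_eq (hψ : M.IsRealization ψ) (A : Finset (Fin n)) :
    Nat.card (M.rtor ψ A) = Nat.card (M.tor A) := by
  obtain ⟨e⟩ := hψ A
  exact (card_torsion_congr R e).symm

omit [IsDomain R] in
theorem isTorsion_tor (M : RMatroid R n) (A : Finset (Fin n)) : Module.IsTorsion R (M.tor A) :=
  Submodule.torsion_isTorsion

omit [IsDomain R] in
theorem isTorsion_rtor (M : RMatroid R n) (ψ : Fin n → M.obj ∅) (A : Finset (Fin n)) :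
    Module.IsTorsion R (M.rtor ψ A) :=
  Submodule.torsion_isTorsion

variable [IsPrincipalIdealRing R]

theorem finite_gr [Ring.HasFiniteQuotients R] : Finite (Gr M ψ) := by
  have (A : Finset (Fin n)) : Finite (Dual R (M.rtor ψ A)) :=
    finite_dual_of_isTorsion R (M.isTorsion_rtor ψ A)
  refine Finite.of_injective
    (fun p : Gr M ψ => (⟨p.set, p.char⟩ : (A : Finset (Fin n)) × Dual R (M.rtor ψ A))) ?_
  rintro ⟨A, _, l⟩ ⟨B, _, l'⟩ h
  obtain ⟨rfl, h⟩ := Sigma.mk.inj h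
  obtain rfl := eq_of_heq h
  rfl

omit [IsPrincipalIdealRing R] in
/-- The elements of the link with given underlying independent set. -/
theorem card_link_fiber (hψ : M.IsRealization ψ) {A : Finset (Fin n)} (hA : M.Indep A) :
    Nat.card {p : M.Link ψ // p.1.set = A} =
      Nat.card (LinearMap.ker (M.dualProj ψ (Finset.empty_subset A))) := by
  refine (Nat.card_eq_of_bijective
    (fun l => ⟨⟨⟨A, hA, l.1⟩, (Gr.base_le_iff hψ).mpr (LinearMap.mem_ker.mp l.2)⟩, rfl⟩)
    ⟨?_, ?_⟩).symm
  · intro l l' h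
    have h1 := congrArg (fun p => p.1.1) h
    simp only [Gr.mk.injEq, heq_eq_eq, true_and] at h1
    exact Subtype.ext h1
  · rintro ⟨⟨p, hp⟩, rfl⟩
    exact ⟨⟨p.char, LinearMap.mem_ker.mpr ((Gr.base_le_iff hψ).mp hp)⟩, rfl⟩

/-- The fibre is the kernel of the dual of the embedding tor(∅) → tor(A). This factor |tor(∅)| is
why the face module has that many copies of the face ring. -/
theorem card_link_fiber_mul (hψ : M.IsRealization ψ) {A : Finset (Fin n)} (hA : M.Indep A) :
    Nat.card {p : M.Link ψ // p.1.set = A} * Nat.card (M.tor ∅) = Nat.card (M.tor A) := by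
  rw [card_link_fiber hψ hA, ← card_tor_eq hψ, ← card_tor_eq hψ]
  exact card_ker_lcomp_mul R (M.isTorsion_rtor ψ ∅) (M.isTorsion_rtor ψ A) _
    (torProj_injective hψ hA)

theorem phi_torDualClass (M : RMatroid R n) (A : Finset (Fin n)) :
    phi R (M.torDualClass A) = Nat.card (M.tor A) := by
  have : Module.Finite R (Dual R (M.tor A)) := finite_dual R (M.tor A) (M.isTorsion_tor A)
  rw [torDualClass, phi_torsion R _ (isTorsion_dual R (M.isTorsion_tor A)),
    card_dual R (M.isTorsion_tor A)]

/-! ### The Hilbert series of the face module -/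

/-- The basis of the face module which consists of the standard monomials in all copies of the
face ring. -/
def faceModuleBasis (K : Type v) [Field K] [Finite (M.Link ψ)] (hψ : M.IsRealization ψ) :
    Module.Basis ((_ : M.tor ∅) × StdIndex fun p : M.Link ψ => p.1.set) K (FaceModule K M ψ) :=
  Finsupp.basis fun _ => stdBasis K (isSimplicial_link hψ)

omit [IsPrincipalIdealRing R] in
theorem mem_faceModuleDeg_iff (K : Type v) [Field K] [Finite (M.Link ψ)]
    (hψ : M.IsRealization ψ) (i : ℕ) (x : FaceModule K M ψ) : x ∈ M.faceModuleDeg K ψ i ↔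
      ∀ j, (faceModuleBasis K hψ).repr x j ≠ 0 → j.2.1.2.degree = i := by
  rw [faceModuleDeg, Finsupp.mem_submodule_iff]
  simp only [mem_faceRingDeg_iff K (isSimplicial_link hψ)]
  exact ⟨fun h j => h j.1 j.2, fun h t s => h ⟨t, s⟩⟩

/-- The elements of the basis of the face module of given degree. -/
def degreeEquiv (M : RMatroid R n) (ψ : Fin n → M.obj ∅) (i : ℕ) :
    {j : (_ : M.tor ∅) × StdIndex fun p : M.Link ψ => p.1.set // j.2.1.2.degree = i} ≃
      M.tor ∅ × ((p : M.Link ψ) × exponents p.1.set i) :=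
  ({ toFun := fun j => (j.1.1, ⟨j.1.2, j.2⟩)
     invFun := fun j => ⟨⟨j.1, j.2.1⟩, j.2.2⟩
     left_inv := fun _ => rfl
     right_inv := fun _ => rfl } : _ ≃ M.tor ∅ ×
      {s : StdIndex fun p : M.Link ψ => p.1.set // s.1.2.degree = i}).trans
    (Equiv.prodCongr (Equiv.refl _) (stdIndexDegEquiv _ i))

variable [Ring.HasFiniteQuotients R]

instance finite_link : Finite (M.Link ψ) :=
  have : Finite (Gr M ψ) := finite_gr
  Finite.of_injective (fun p : M.Link ψ => p.1) Subtype.val_injective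

theorem isInternal_faceModuleDeg (K : Type v) [Field K] (hψ : M.IsRealization ψ) :
    DirectSum.IsInternal (M.faceModuleDeg K ψ) :=
  isInternal_of_basis (faceModuleBasis K hψ) _ _ (mem_faceModuleDeg_iff K hψ)

theorem finite_faceModuleDeg (K : Type v) [Field K] (hψ : M.IsRealization ψ) (i : ℕ) :
    Module.Finite K (M.faceModuleDeg K ψ i) :=
  have : Finite (M.tor ∅) := finite_of_isTorsion R (M.isTorsion_tor ∅)
  have := Finite.of_equiv _ (M.degreeEquiv ψ i).symm
  finite_of_basis (faceModuleBasis K hψ) _ _ (mem_faceModuleDeg_iff K hψ) i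

-- Group the standard monomials by the underlying set of their top element; the number of copies
-- times the size of the fibre over A is |tor(A)|.
open Classical in
theorem hilbertSeries_faceModule (K : Type v) [Field K] (hψ : M.IsRealization ψ) :
    hilbertSeries K (M.faceModuleDeg K ψ) = ∑ A : Finset (Fin n), if M.Indep A then
      (Nat.card (M.tor A) : PowerSeries ℚ) * (PowerSeries.X * (1 - PowerSeries.X)⁻¹) ^ A.card
      else 0 := by
  have := Fintype.ofFinite (M.Link ψ)
  have h1 : hilbertSeries K (M.faceModuleDeg K ψ) = (Nat.card (M.tor ∅) : PowerSeries ℚ) *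
      ∑ p : M.Link ψ, (PowerSeries.X * (1 - PowerSeries.X)⁻¹) ^ p.1.set.card := by
    ext i
    rw [hilbertSeries, PowerSeries.coeff_mk,
      finrank_of_basis (faceModuleBasis K hψ) _ _ (mem_faceModuleDeg_iff K hψ) i,
      Nat.card_congr (M.degreeEquiv ψ i), Nat.card_prod, Nat.card_sigma]
    simp only [← mk_card_exponents]
    rw [← map_natCast (PowerSeries.C (R := ℚ)), PowerSeries.coeff_C_mul, map_sum]
    simp
  rw [h1, ← Finset.sum_fiberwise (s := Finset.univ) (g := fun p : M.Link ψ => p.1.set),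
    Finset.mul_sum]
  refine Finset.sum_congr rfl fun A _ => ?_
  rw [Finset.sum_congr rfl (g := fun _ => (PowerSeries.X * (1 - PowerSeries.X)⁻¹) ^ A.card)
    fun p hp => by rw [(Finset.mem_filter.mp hp).2], Finset.sum_const, nsmul_eq_mul]
  split_ifs with hA
  · rw [← mul_assoc, ← card_link_fiber_mul hψ hA,
      Nat.card_eq_fintype_card (α := {p : M.Link ψ // p.1.set = A}), Fintype.card_subtype,
      Nat.cast_mul, mul_comm (Nat.cast (Nat.card (M.tor ∅)))]
  · rw [Finset.filter_eq_empty_iff.mpr fun p _ (hp : p.1.set = A) => hA (hp ▸ p.1.indep)]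
    simp

-- At y = 1 the factor of a dependent set is a positive power of 0, while independent sets give 0^0
-- = 1.
omit [Ring.HasFiniteQuotients R] in
open Classical in
theorem specialize_tutteTilde (hψ : M.IsRealization ψ) :
    specialize M.tutteTilde = ∑ A : Finset (Fin n), if M.Indep A then
      (Nat.card (M.tor A) : LaurentSeries ℚ) *
        (((PowerSeries.X : PowerSeries ℚ) : LaurentSeries ℚ)⁻¹ - 1) ^ (M.rank - A.card)
      else 0 := by
  rw [specialize, tutteTilde, tutte, map_sum, MvPolynomial.eval₂_sum]
  refine Finset.sum_congr rfl fun A _ => ?_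
  simp only [map_mul, map_pow, map_sub, map_one, MvPolynomial.map_C, MvPolynomial.map_X,
    phi_torDualClass, ← MvPolynomial.coe_eval₂Hom, MvPolynomial.eval₂Hom_X', Matrix.cons_val_zero,
    Matrix.cons_val_one, sub_self, map_natCast]
  split_ifs with hA
  · rw [show M.rk A = A.card from hA, Nat.sub_self, pow_zero, mul_one]
  · rw [zero_pow, mul_zero]
    have := rk_le_card hψ A
    have : M.rk A ≠ A.card := hA
    lia

theorem coe_hilbertSeries (K : Type v) [Field K] (hψ : M.IsRealization ψ) :
    ((hilbertSeries K (M.faceModuleDeg K ψ) : PowerSeries ℚ) : LaurentSeries ℚ) =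
      ((PowerSeries.X : PowerSeries ℚ) : LaurentSeries ℚ) ^ M.rank /
          (1 - ((PowerSeries.X : PowerSeries ℚ) : LaurentSeries ℚ)) ^ M.rank *
        specialize M.tutteTilde := by
  classical
  let c := HahnSeries.ofPowerSeries ℤ ℚ
  have hc : Function.Injective c := HahnSeries.ofPowerSeries_injective
  set t : LaurentSeries ℚ := c PowerSeries.X with ht
  have ht0 : t ≠ 0 := (map_ne_zero_iff c hc).mpr PowerSeries.X_ne_zero
  have h1 : c (1 - PowerSeries.X) = 1 - t := by rw [map_sub, map_one]
  have ht1 : 1 - t ≠ 0 := by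
    rw [← h1]
    refine (map_ne_zero_iff c hc).mpr fun h => ?_
    simpa using congrArg PowerSeries.constantCoeff h
  have hinv : c (1 - PowerSeries.X)⁻¹ = (1 - t)⁻¹ := by
    refine eq_inv_of_mul_eq_one_left ?_
    rw [← h1, ← map_mul, PowerSeries.inv_mul_cancel _ (by simp), map_one]
  rw [hilbertSeries_faceModule K hψ, specialize_tutteTilde hψ, Finset.mul_sum]
  change c _ = _
  rw [map_sum]
  refine Finset.sum_congr rfl fun A _ => ?_
  change _ = t ^ M.rank / (1 - t) ^ M.rank * _
  split_ifs with hA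
  · rw [map_mul, map_natCast, map_pow, map_mul, hinv]
    change _ = t ^ M.rank / (1 - t) ^ M.rank * (_ * (t⁻¹ - 1) ^ _)
    have hr := rk_le_rank hψ A
    rw [show M.rk A = A.card from hA] at hr
    -- With r = |A| + k, the claim for A follows from 1/t - 1 = (1 - t)/t.
    obtain ⟨k, hk⟩ := Nat.exists_eq_add_of_le hr
    rw [hk, Nat.add_sub_cancel_left, ← ht]
    have : t⁻¹ - 1 = (1 - t) * t⁻¹ := by field_simp
    rw [this, mul_pow, mul_pow, inv_pow, inv_pow, pow_add, pow_add]
    field_simp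
  · rw [map_zero, mul_zero]

end RMatroid

end RMat

end

theorem theorem5p4 (F : Type u) [Field F] [NumberField F]
    [IsPrincipalIdealRing (NumberField.RingOfIntegers F)]
    (K : Type v) [Field K] (n r : ℕ) (M : RMat.RMatroid (NumberField.RingOfIntegers F) n)
    (ψ : Fin n → M.obj ∅) (hψ : M.IsRealization ψ) (hr : M.rank = r) :
    -- the poset of torsions is finite
    Finite (RMat.RMatroid.Gr M ψ) ∧
    -- the face module is graded, with homogeneous parts of finite dimension
    DirectSum.IsInternal (M.faceModuleDeg K ψ) ∧
    (∀ i, Module.Finite K (M.faceModuleDeg K ψ i)) ∧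
    -- the formula for its Hilbert series
    ((RMat.hilbertSeries K (M.faceModuleDeg K ψ) : PowerSeries ℚ) : LaurentSeries ℚ) =
      ((PowerSeries.X : PowerSeries ℚ) : LaurentSeries ℚ) ^ r /
          (1 - ((PowerSeries.X : PowerSeries ℚ) : LaurentSeries ℚ)) ^ r *
        RMat.specialize M.tutteTilde := by
  subst hr
  exact ⟨RMat.RMatroid.finite_gr, RMat.RMatroid.isInternal_faceModuleDeg K hψ,
    RMat.RMatroid.finite_faceModuleDeg K hψ, RMat.RMatroid.coe_hilbertSeries K hψ⟩
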